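/- Let $k$ be a field and let $S\subseteq\mathbb{N}$ be a numerical semigroup (a submonoid of $(\mathbb{N},+)$ with finite complement), with multiplicity $e$ (its least nonzero element) and embedding dimension $v$ (the number of its minimal generators). Let $R=k[[S]]\subseteq k[[t]]$ be the ring of the power series all of whose exponents lie in $S$, a local ring with maximal ideal $\mathfrak m$, and let $H_R(n)=\dim_{R/\mathfrak m}(\mathfrak m^n/\mathfrak m^{n+1})$ for $n\ge 0$ be its Hilbert function. If $R$ is Gorenstein (that is, a Noetherian local ring of finite injective dimension as a module over itself) and $v\ge e-4$, then $H_R$ is non-decreasing: $H_R(n)\le H_R(n+1)$ for all $n\ge 0$. -/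

import Mathlib

universe u

section NumericalSemigroups

/-- A numerical semigroup: a submonoid of `ℕ` whose complement in `ℕ` is finite. -/
def IsNumericalSemigroup (S : AddSubmonoid ℕ) : Prop :=
  ((S : Set ℕ)ᶜ).Finite

/-- The multiplicity `e` of a numerical semigroup: its least nonzero element. -/
noncomputable def semigroupMultiplicity (S : AddSubmonoid ℕ) : ℕ :=
  sInf {s : ℕ | s ∈ S ∧ s ≠ 0}

/-- The minimal generators of `S`: with `M = S \ {0}`, the set `M \ (M + M)` of the nonzero
elements of `S` that are not a sum of two nonzero elements of `S`. -/
def minimalGenerators (S : AddSubmonoid ℕ) : Set ℕ :=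
  {s : ℕ | s ∈ S ∧ s ≠ 0 ∧ ∀ a ∈ S, ∀ b ∈ S, a ≠ 0 → b ≠ 0 → a + b ≠ s}

/-- The embedding dimension `v` of a numerical semigroup: the number of its minimal
generators. -/
noncomputable def semigroupEmbeddingDimension (S : AddSubmonoid ℕ) : ℕ :=
  (minimalGenerators S).ncard

end NumericalSemigroups

section SemigroupRing

/-- The semigroup ring `k[[S]]`: the `k`-subalgebra of `k[[t]]` of the power series all of whose
exponents lie in `S`. -/
def semigroupRing (k : Type u) [Field k] (S : AddSubmonoid ℕ) :
    Subalgebra k (PowerSeries k) where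
  carrier := {f | ∀ n, PowerSeries.coeff n f ≠ 0 → n ∈ S}
  mul_mem' := by
    intro f g hf hg n hn
    rw [PowerSeries.coeff_mul] at hn
    obtain ⟨p, hp, hne⟩ := Finset.exists_ne_zero_of_sum_ne_zero hn
    rw [← Finset.HasAntidiagonal.mem_antidiagonal.mp hp]
    exact S.add_mem (hf _ (left_ne_zero_of_mul hne)) (hg _ (right_ne_zero_of_mul hne))
  add_mem' := by
    intro f g hf hg n hn
    by_cases h : PowerSeries.coeff n f = 0
    · refine hg n fun h' => hn ?_
      rw [map_add, h, h', add_zero]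
    · exact hf n h
  algebraMap_mem' := by
    intro r n hn
    by_cases h : n = 0
    · rw [h]
      exact S.zero_mem
    · refine absurd ?_ hn
      rw [PowerSeries.algebraMap_apply, Algebra.algebraMap_self, RingHom.id_apply,
        PowerSeries.coeff_C, if_neg h]

/-- The inverse in `k[[t]]` of a power series of `k[[S]]` lies in `k[[S]]`. -/
theorem inv_mem_semigroupRing {k : Type u} [Field k] {S : AddSubmonoid ℕ} {f : PowerSeries k}
    (hf : f ∈ semigroupRing k S) : f⁻¹ ∈ semigroupRing k S := by
  intro n
  induction n using Nat.strong_induction_on with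
  | _ n ih =>
    intro hn
    by_cases h0 : n = 0
    · rw [h0]
      exact S.zero_mem
    rw [PowerSeries.coeff_inv, if_neg h0] at hn
    obtain ⟨p, hp, hne⟩ := Finset.exists_ne_zero_of_sum_ne_zero (right_ne_zero_of_mul hn)
    by_cases hlt : p.2 < n
    · rw [if_pos hlt] at hne
      rw [← Finset.HasAntidiagonal.mem_antidiagonal.mp hp]
      exact S.add_mem (hf _ (left_ne_zero_of_mul hne)) (ih _ hlt (right_ne_zero_of_mul hne))
    · rw [if_neg hlt] at hne
      exact absurd rfl hne

/-- The ring `k[[S]]` is local. -/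
instance semigroupRing_isLocalRing (k : Type u) [Field k] (S : AddSubmonoid ℕ) :
    IsLocalRing (semigroupRing k S) := by
  have key : ∀ a : semigroupRing k S,
      PowerSeries.constantCoeff (a : PowerSeries k) ≠ 0 → IsUnit a := fun a ha =>
    IsUnit.of_mul_eq_one ⟨(a : PowerSeries k)⁻¹, inv_mem_semigroupRing a.2⟩
      (Subtype.ext (PowerSeries.mul_inv_cancel _ ha))
  refine IsLocalRing.of_isUnit_or_isUnit_one_sub_self fun a => ?_
  by_cases ha : PowerSeries.constantCoeff (a : PowerSeries k) = 0
  · refine Or.inr (key _ ?_)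
    have h1 : ((1 - a : semigroupRing k S) : PowerSeries k) = 1 - (a : PowerSeries k) := rfl
    rw [h1, map_sub, ha, map_one, sub_zero]
    exact one_ne_zero
  · exact Or.inl (key _ ha)

end SemigroupRing

section LocalRings

/-- The Hilbert function of a local ring `R` with maximal ideal `m`:
`n ↦ dim_{R/m} (m^n / m^(n+1))`, where `m^(n+1) = m • m^n`. -/
noncomputable def hilbertFunction (R : Type u) [CommRing R] [IsLocalRing R] (n : ℕ) : ℕ :=
  Module.finrank (R ⧸ IsLocalRing.maximalIdeal R)
    (↥(IsLocalRing.maximalIdeal R ^ n) ⧸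
      (IsLocalRing.maximalIdeal R • ⊤ : Submodule R ↥(IsLocalRing.maximalIdeal R ^ n)))

/-- A Gorenstein local ring: a Noetherian local ring that has finite injective dimension as a
module over itself. -/
structure IsGorensteinLocalRing (R : Type u) [CommRing R] : Prop where
  isNoetherianRing : IsNoetherianRing R
  isLocalRing : IsLocalRing R
  exists_hasInjectiveDimensionLE :
    ∃ n : ℕ, CategoryTheory.HasInjectiveDimensionLE (ModuleCat.of R R) n

end LocalRings

/-!
Write `M = S \ {0}` and `e` for the multiplicity. The order of `s ∈ S` is the largest number of
summands in an expression of `s` as a sum of elements of `M`. The `n`-th power of the maximal ideal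
of `k[[S]]` consists of the series whose exponents have order at least `n`, so the Hilbert function
at `n` is the number of elements of order `n` (`semigroupRing.hilbertFunction_eq`).

Adding `e` raises the order by at least one. Call `s` a jump if the order goes up by more than one,
and call an element of order `n + 1` fresh if it is not `s + e` with `s` of order `n`. Then
`H(n + 1) - H(n)` is the number of fresh elements of order `n + 1` minus the number of jumps of
order `n`, and it remains to see that this is nonnegative (`ncard_jumps_le_of_symmetric`).

*Symmetry.* If `R = k[[S]]` has finite injective dimension, then `Ext^i(N, R)` vanishes for `N` of
finite length and `i` large. Since `Ext^i(R / t ^ e, R) = 0` for `i ≥ 2` and the residue field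
embeds into `R / t ^ e`, the vanishing descends to `i = 2`. This makes every map from the residue
field to `R / t ^ e` extend to `R / t ^ e` (`exists_mul_sub_mem_of_socle`), so that the socle of
`R / t ^ e` is one-dimensional. The socle contains `t ^ a` for the maximal elements `a` of the
Apéry set; hence there is a single one, `W`, and `w ↦ W - w` is a duality of the Apéry set
(`semigroupRing.exists_apery_duality`).

*Fresh elements.* A part of a longest factorization of a fresh element is a longest factorization
of a fresh element. If `x` is a jump of order `n`, then `x + e` is fresh of order at least `n + 2`,
which produces fresh elements of order `n + 1`; moreover two jumps of the same order never differ
by a nonzero element of `S` (`ncard_jumps_le`). The Apéry set has at most `e - v ≤ 4` elements of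
order at least two, and the duality leaves at most three fresh elements of order two.

* If these are not of the form `2g, g + h, 2h`, every fresh element of order `m ≥ 3` is
  `(m - 1) p + q` with `2p` fresh, or `m = 3` and it is a sum of three distinct elements
  (`IsFreshFactorization.shape`). In the first case, sending the jump `x` with
  `x + e = (m - 1) p + q` to `n p + q` is injective; in the second there is only one jump
  (`ncard_jumps_le_of_forall_add_self_notMem`).
* Otherwise all fresh elements of order at least two are combinations `i g + j h`, and they form
  the staircase of a monomial ideal in two variables. The duality forces, up to exchanging `g` and
  `h`, that `W = 2g + h`. If `3g = x + e` and `g + 2h = y + e` were both fresh, then `W - x` and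
  `W - y` would be elements of the Apéry set with sum `2e`, which is impossible because nonzero
  elements of the Apéry set exceed `e`. So one of `3g`, `g + 2h` is missing, and the staircase is
  so thin that it cannot grow (`ncard_jumps_le_of_eq`).
-/

namespace AddSubmonoid

/-! ### Orders of elements and the Apéry set -/

variable {S : AddSubmonoid ℕ} {e n : ℕ}

/-- A factorization in `S`: a multiset of nonzero elements of `S`, viewed as a way of writing its
sum. The parts need not be minimal generators. -/
def IsFactorization (S : AddSubmonoid ℕ) (m : Multiset ℕ) : Prop :=
  ∀ a ∈ m, a ∈ S ∧ a ≠ 0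

/-- The order of `s ∈ S`: the largest number of parts in a factorization of `s`, that is, the
largest `n` with `s ∈ n (S \ {0})`. -/
noncomputable def order (S : AddSubmonoid ℕ) (s : ℕ) : ℕ :=
  sSup {n | ∃ m : Multiset ℕ, S.IsFactorization m ∧ m.sum = s ∧ m.card = n}

/-- The elements of `S` of order `n`. -/
def level (S : AddSubmonoid ℕ) (n : ℕ) : Set ℕ :=
  {s | s ∈ S ∧ S.order s = n}

/-- The elements of order `n` that do not arise from an element of order `n - 1` by adding `e`.
They index a monomial basis in degree `n` of the associated graded ring of `k[[S]]` modulo the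
initial form of `t ^ e`. -/
def fresh (S : AddSubmonoid ℕ) (e n : ℕ) : Set ℕ :=
  {s | s ∈ S ∧ S.order s = n ∧ ∀ t ∈ S, t + e = s → S.order t + 1 < n}

/-- The elements of order `n` whose order increases by more than one when `e` is added. They index
a monomial basis in degree `n` of the annihilator of the initial form of `t ^ e`. -/
def jumps (S : AddSubmonoid ℕ) (e n : ℕ) : Set ℕ :=
  {s | s ∈ S ∧ S.order s = n ∧ n + 1 < S.order (s + e)}

/-- The Apéry set of `S` with respect to `e`. -/
def apery (S : AddSubmonoid ℕ) (e : ℕ) : Set ℕ :=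
  {s | s ∈ S ∧ ∀ t ∈ S, t + e ≠ s}

/-- `e` is the least nonzero element of `S`. -/
structure IsMultiplicity (S : AddSubmonoid ℕ) (e : ℕ) : Prop where
  mem : e ∈ S
  ne_zero : e ≠ 0
  le : ∀ s ∈ S, s ≠ 0 → e ≤ s

theorem IsFactorization.sum_mem {m : Multiset ℕ} (h : S.IsFactorization m) : m.sum ∈ S :=
  S.multiset_sum_mem m fun a ha => (h a ha).1

theorem IsFactorization.mono {m m' : Multiset ℕ} (h : S.IsFactorization m) (hle : m' ≤ m) :
    S.IsFactorization m' :=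
  fun a ha => h a (Multiset.mem_of_le hle ha)

theorem IsFactorization.add {m m' : Multiset ℕ} (h : S.IsFactorization m)
    (h' : S.IsFactorization m') : S.IsFactorization (m + m') := fun a ha =>
  (Multiset.mem_add.mp ha).elim (h a) (h' a)

theorem IsFactorization.card_le_sum {m : Multiset ℕ} (h : S.IsFactorization m) :
    m.card ≤ m.sum := by
  have := Multiset.card_nsmul_le_sum (s := m) (a := 1)
    fun a ha => Nat.one_le_iff_ne_zero.mpr (h a ha).2
  simpa using this

theorem bddAbove_card_factorization (S : AddSubmonoid ℕ) (s : ℕ) :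
    BddAbove {n | ∃ m : Multiset ℕ, S.IsFactorization m ∧ m.sum = s ∧ m.card = n} :=
  ⟨s, by rintro _ ⟨m, hm, rfl, rfl⟩; exact hm.card_le_sum⟩

theorem IsFactorization.card_le_order {m : Multiset ℕ} (h : S.IsFactorization m) :
    m.card ≤ S.order m.sum :=
  le_csSup (bddAbove_card_factorization S _) ⟨m, h, rfl, rfl⟩

theorem exists_factorization_card_eq_order {s : ℕ} (hs : s ∈ S) :
    ∃ m : Multiset ℕ, S.IsFactorization m ∧ m.sum = s ∧ m.card = S.order s := by
  refine Nat.sSup_mem ?_ (bddAbove_card_factorization S s)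
  by_cases h0 : s = 0
  · exact ⟨0, 0, fun a ha => absurd ha (Multiset.notMem_zero a), by simp [h0], rfl⟩
  · exact ⟨1, {s}, fun a ha => by rw [Multiset.mem_singleton.mp ha]; exact ⟨hs, h0⟩, by simp,
      by simp⟩

theorem order_le (hs : n ∈ S) : S.order n ≤ n := by
  obtain ⟨m, hm, hsum, hcard⟩ := exists_factorization_card_eq_order hs
  rw [← hcard]
  exact hm.card_le_sum.trans hsum.le

theorem order_zero : S.order 0 = 0 :=
  Nat.le_zero.mp (order_le S.zero_mem)

theorem one_le_order {s : ℕ} (hs : s ∈ S) (h0 : s ≠ 0) : 1 ≤ S.order s := by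
  have : S.IsFactorization {s} := fun a ha => by
    rw [Multiset.mem_singleton.mp ha]; exact ⟨hs, h0⟩
  simpa using this.card_le_order

theorem order_add_le {a b : ℕ} (ha : a ∈ S) (hb : b ∈ S) :
    S.order a + S.order b ≤ S.order (a + b) := by
  obtain ⟨m, hm, rfl, hcard⟩ := exists_factorization_card_eq_order ha
  obtain ⟨m', hm', rfl, hcard'⟩ := exists_factorization_card_eq_order hb
  rw [← hcard, ← hcard', ← Multiset.card_add, ← Multiset.sum_add]
  exact (hm.add hm').card_le_order

theorem two_le_order_add {a b : ℕ} (ha : a ∈ S) (hb : b ∈ S) (ha0 : a ≠ 0) (hb0 : b ≠ 0) :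
    2 ≤ S.order (a + b) :=
  (add_le_add (one_le_order ha ha0) (one_le_order hb hb0)).trans (order_add_le ha hb)

theorem exists_add_of_succ_le_order {s : ℕ} (hs : s ∈ S) (h : n + 1 ≤ S.order s) :
    ∃ a ∈ S, S.order a = 1 ∧ ∃ b ∈ S, n ≤ S.order b ∧ a + b = s := by
  obtain ⟨m, hm, rfl, hcard⟩ := exists_factorization_card_eq_order hs
  obtain ⟨a, ha⟩ := Multiset.card_pos_iff_exists_mem.mp (by omega : 0 < m.card)
  obtain ⟨m', rfl⟩ := Multiset.exists_cons_of_mem ha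
  have hm' := hm.mono (Multiset.le_cons_self m' a)
  have := hm'.card_le_order
  rw [Multiset.card_cons] at hcard
  have h1 := order_add_le (hm a ha).1 hm'.sum_mem
  have h2 := one_le_order (hm a ha).1 (hm a ha).2
  rw [Multiset.sum_cons] at hcard h
  exact ⟨a, (hm a ha).1, by omega, m'.sum, hm'.sum_mem, by omega, (Multiset.sum_cons a m').symm⟩

theorem mem_minimalGenerators_iff {s : ℕ} :
    s ∈ minimalGenerators S ↔ s ∈ S ∧ S.order s = 1 := by
  constructor
  · rintro ⟨hs, h0, h⟩
    refine ⟨hs, le_antisymm (not_lt.mp fun hlt => ?_) (one_le_order hs h0)⟩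
    obtain ⟨a, ha, ha0, b, hb, hb1, hab⟩ := exists_add_of_succ_le_order hs hlt
    exact h a ha b hb (fun h0 => by rw [h0, order_zero] at ha0; omega)
      (fun hb0 => by rw [hb0, order_zero] at hb1; omega) hab
  · rintro ⟨hs, h1⟩
    refine ⟨hs, fun h0 => by rw [h0, order_zero] at h1; omega, ?_⟩
    rintro a ha b hb ha0 hb0 rfl
    have := two_le_order_add ha hb ha0 hb0
    omega

theorem mem_fresh_of_mem_apery {s : ℕ} (hs : s ∈ S.apery e) : s ∈ S.fresh e (S.order s) :=
  ⟨hs.1, rfl, fun t ht hte => absurd hte (hs.2 t ht)⟩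

theorem eq_of_mem_jumps {x x' y p j j' : ℕ} (hx : x ∈ S.jumps e n) (hx' : x' ∈ S.jumps e n)
    (hp : p ∈ S) (h : x + e = y + j * p) (h' : x' + e = y + j' * p) : x = x' := by
  wlog hle : j ≤ j' generalizing x x' j j'
  · exact (this hx' hx h' h (by omega)).symm
  obtain ⟨i, rfl⟩ := Nat.exists_eq_add_of_le hle
  have hxx : x' = x + i * p := by rw [add_mul] at h'; omega
  by_contra hne
  have hip : i * p ∈ S := by simpa using S.nsmul_mem hp i
  have h1 := order_add_le hx.1 hip
  have h2 := one_le_order hip (by omega)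
  rw [← hxx, hx.2.1, hx'.2.1] at h1
  omega

namespace IsMultiplicity

variable (he : S.IsMultiplicity e)
include he

theorem order_eq_one : S.order e = 1 := by
  refine (mem_minimalGenerators_iff.mp ⟨he.mem, he.ne_zero, ?_⟩).2
  intro a ha b hb ha0 hb0 h
  have := he.le a ha ha0
  omega

theorem order_succ_le {t : ℕ} (ht : t ∈ S) : S.order t + 1 ≤ S.order (t + e) := by
  have := order_add_le ht he.mem
  rwa [he.order_eq_one] at this

theorem add_mem_fresh {x : ℕ} (hx : x ∈ S.jumps e n) : x + e ∈ S.fresh e (S.order (x + e)) :=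
  ⟨S.add_mem hx.1 he.mem, rfl, fun t _ hte => by
    obtain rfl := Nat.add_right_cancel hte
    rw [hx.2.1]
    exact hx.2.2⟩

theorem fresh_two_subset : S.fresh e 2 ⊆ S.apery e := by
  rintro s ⟨hs, h2, h⟩
  refine ⟨hs, fun t ht hte => ?_⟩
  have h3 := h t ht hte
  have h0 : t = 0 := by
    by_contra h0
    have := one_le_order ht h0
    omega
  rw [h0, zero_add] at hte
  rw [← hte, he.order_eq_one] at h2
  omega

theorem lt_of_mem_apery {s : ℕ} (hs : s ∈ S.apery e) (h0 : s ≠ 0) : e < s :=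
  lt_of_le_of_ne (he.le s hs.1 h0) fun h => hs.2 0 S.zero_mem (by omega)

theorem zero_mem_apery : 0 ∈ S.apery e :=
  ⟨S.zero_mem, fun t _ h => he.ne_zero (by omega)⟩

theorem mul_add_mem {t : ℕ} (ht : t ∈ S) (i : ℕ) : t + i * e ∈ S :=
  S.add_mem ht (by simpa using S.nsmul_mem he.mem i)

theorem injOn_mod_apery : Set.InjOn (· % e) (S.apery e) := by
  have key : ∀ a ∈ S.apery e, ∀ b ∈ S.apery e, a % e = b % e → a ≤ b → a = b := by
    intro a ha b hb hab hle
    obtain ⟨i, hi⟩ := (Nat.modEq_iff_dvd' hle).mp hab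
    rcases i with _ | i
    · omega
    · refine absurd ?_ (hb.2 (a + i * e) (he.mul_add_mem ha.1 i))
      have : e * (i + 1) = i * e + e := by ring
      omega
  intro a ha b hb hab
  rcases le_total a b with h | h
  · exact key a ha b hb hab h
  · exact (key b hb a ha hab.symm h).symm

theorem mapsTo_mod_apery : Set.MapsTo (· % e) (S.apery e) (Finset.range e : Set ℕ) := fun s _ => by
  simpa using Nat.mod_lt s (Nat.pos_of_ne_zero he.ne_zero)

theorem finite_apery : (S.apery e).Finite :=
  Set.Finite.of_injOn he.mapsTo_mod_apery he.injOn_mod_apery (Finset.finite_toSet _)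

theorem ncard_apery_le : (S.apery e).ncard ≤ e := by
  have := Set.ncard_le_ncard_of_injOn _ he.mapsTo_mod_apery he.injOn_mod_apery
    (Finset.finite_toSet _)
  rwa [Set.ncard_coe_finset, Finset.card_range] at this

/-- The elements of the Apéry set are `0`, the minimal generators other than `e`, and at most
`e - v` elements of order at least two. -/
theorem ncard_apery_two_le_order_add_le :
    {s ∈ S.apery e | 2 ≤ S.order s}.ncard + semigroupEmbeddingDimension S ≤ e := by
  have hfin := he.finite_apery
  have hgen : minimalGenerators S \ {e} ⊆ S.apery e := by
    rintro s ⟨hs, hse⟩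
    refine ⟨hs.1, fun t ht hte => ?_⟩
    refine hs.2.2 t ht e he.mem (fun h0 => hse ?_) he.ne_zero hte
    rw [Set.mem_singleton_iff]; omega
  have hemem : e ∈ minimalGenerators S := mem_minimalGenerators_iff.mpr ⟨he.mem, he.order_eq_one⟩
  have hgfin : (minimalGenerators S).Finite :=
    (hfin.subset hgen).of_sdiff (Set.finite_singleton e)
  have h1 : (minimalGenerators S \ {e}).ncard + 1 = (minimalGenerators S).ncard :=
    Set.ncard_sdiff_singleton_add_one hemem hgfin
  have hd1 : Disjoint {s ∈ S.apery e | 2 ≤ S.order s} (minimalGenerators S \ {e}) := by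
    rw [Set.disjoint_left]
    rintro s ⟨_, h2⟩ ⟨hs, _⟩
    have := (mem_minimalGenerators_iff.mp hs).2
    omega
  have h0 : 0 ∉ {s ∈ S.apery e | 2 ≤ S.order s} ∪ (minimalGenerators S \ {e}) := by
    rintro (⟨_, h⟩ | ⟨h, _⟩)
    · rw [order_zero] at h; omega
    · exact h.2.1 rfl
  have hfin2 : ({s ∈ S.apery e | 2 ≤ S.order s} ∪ (minimalGenerators S \ {e})).Finite :=
    (hfin.subset (Set.sep_subset _ _)).union (hfin.subset hgen)
  have h2 := Set.ncard_union_eq hd1 (hfin.subset (Set.sep_subset _ _)) (hfin.subset hgen)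
  have h3 := Set.ncard_insert_of_notMem h0 hfin2
  have h4 := Set.ncard_le_ncard (s := insert 0 ({s ∈ S.apery e | 2 ≤ S.order s} ∪
    (minimalGenerators S \ {e}))) (t := S.apery e)
    (Set.insert_subset he.zero_mem_apery (Set.union_subset (Set.sep_subset _ _) hgen)) hfin
  have h5 := he.ncard_apery_le
  rw [semigroupEmbeddingDimension]
  omega

/-- Elements of order `n` are at most `c + (n + 1) e`, where `c` bounds the complement of `S`: a
larger element is the sum of an element of `S` and of `n + 1` copies of `e`. -/
theorem finite_level (hS : IsNumericalSemigroup S) (n : ℕ) : (S.level n).Finite := by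
  obtain ⟨c, hc⟩ := hS.bddAbove
  refine (Set.finite_Iic (c + (n + 1) * e)).subset fun s hs => ?_
  by_contra hlt
  rw [Set.mem_Iic, not_le] at hlt
  obtain ⟨r, rfl⟩ := Nat.exists_eq_add_of_le hlt.le
  have hr0 : r ≠ 0 := by rintro rfl; omega
  have hcr : c + r ∈ S := by
    by_contra h
    have := hc (show c + r ∈ (S : Set ℕ)ᶜ from h)
    omega
  have hf : S.IsFactorization (Multiset.replicate (n + 1) e) := fun a ha => by
    rw [Multiset.eq_of_mem_replicate ha]; exact ⟨he.mem, he.ne_zero⟩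
  have h1 := hf.card_le_order
  have h2 := order_add_le hcr hf.sum_mem
  rw [Multiset.card_replicate] at h1
  rw [Multiset.sum_replicate, smul_eq_mul] at h1 h2
  have h3 := hs.2
  rw [show c + (n + 1) * e + r = c + r + (n + 1) * e by ring] at h3
  omega

/-- Adding `e` maps the elements of order `n` that are not jumps bijectively to the elements of
order `n + 1` that are not fresh. -/
theorem ncard_level_le_ncard_level_succ (hS : IsNumericalSemigroup S)
    (h : (S.jumps e n).ncard ≤ (S.fresh e (n + 1)).ncard) :
    (S.level n).ncard ≤ (S.level (n + 1)).ncard := by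
  have hD : S.jumps e n ⊆ S.level n := fun s hs => ⟨hs.1, hs.2.1⟩
  have hC : S.fresh e (n + 1) ⊆ S.level (n + 1) := fun s hs => ⟨hs.1, hs.2.1⟩
  have h1 := Set.ncard_sdiff_add_ncard_of_subset hD (he.finite_level hS n)
  have h2 := Set.ncard_sdiff_add_ncard_of_subset hC (he.finite_level hS (n + 1))
  have h3 : (S.level n \ S.jumps e n).ncard ≤ (S.level (n + 1) \ S.fresh e (n + 1)).ncard := by
    refine Set.ncard_le_ncard_of_injOn (· + e) ?_ (fun a _ b _ hab => Nat.add_right_cancel hab)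
      ((he.finite_level hS (n + 1)).subset Set.sdiff_subset)
    rintro s ⟨⟨hs, rfl⟩, hsD⟩
    have hle : S.order (s + e) ≤ S.order s + 1 := not_lt.mp fun hlt => hsD ⟨hs, rfl, hlt⟩
    have hge := he.order_succ_le hs
    exact ⟨⟨S.add_mem hs he.mem, by omega⟩, fun hf => (hf.2.2 s hs rfl).ne rfl⟩
  omega

/-- Two jumps of the same order never differ by a nonzero element of `S`; so if every jump `x`
satisfies `x + e = y + j p` with `y` fresh of order `n + 1` and `p` determined by `y`, there are no
more jumps of order `n` than fresh elements of order `n + 1`. -/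
theorem ncard_jumps_le (hS : IsNumericalSemigroup S) (P : ℕ → ℕ → Prop)
    (hP : ∀ y p p', P y p → P y p' → p = p')
    (h : ∀ x ∈ S.jumps e n, ∃ y ∈ S.fresh e (n + 1), ∃ p ∈ S, P y p ∧ ∃ j, x + e = y + j * p) :
    (S.jumps e n).ncard ≤ (S.fresh e (n + 1)).ncard := by
  choose! y hy p hp hyp j hj using h
  refine Set.ncard_le_ncard_of_injOn y hy (fun a ha b hb hab => ?_)
    ((he.finite_level hS (n + 1)).subset fun s hs => ⟨hs.1, hs.2.1⟩)
  have h1 := hj a ha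
  have h2 := hj b hb
  rw [← hab, ← hP (y a) (p a) (p b) (hyp a ha) (hab ▸ hyp b hb)] at h2
  exact eq_of_mem_jumps ha hb (hp a ha) h1 h2

end IsMultiplicity

end AddSubmonoid

namespace AddSubmonoid

/-! ### Factorizations of fresh elements -/

variable {S : AddSubmonoid ℕ} {e n : ℕ}

/-- A longest factorization of a fresh element. -/
structure IsFreshFactorization (S : AddSubmonoid ℕ) (e : ℕ) (m : Multiset ℕ) : Prop where
  isFactorization : S.IsFactorization m
  sum_mem_fresh : m.sum ∈ S.fresh e m.card

theorem exists_freshFactorization {s : ℕ} (hs : s ∈ S.fresh e n) :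
    ∃ m, S.IsFreshFactorization e m ∧ m.sum = s ∧ m.card = n := by
  obtain ⟨m, hm, rfl, hcard⟩ := exists_factorization_card_eq_order hs.1
  have hn : m.card = n := hcard.trans hs.2.1
  exact ⟨m, ⟨hm, hn ▸ hs⟩, rfl, hn⟩

/-- A part of a longest factorization of a fresh element is one as well. -/
theorem IsFreshFactorization.mono {m m' : Multiset ℕ} (hm : S.IsFreshFactorization e m)
    (hle : m' ≤ m) : S.IsFreshFactorization e m' := by
  obtain ⟨r, rfl⟩ := Multiset.le_iff_exists_add.mp hle
  have hm' := hm.1.mono hle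
  have hr := hm.1.mono (Multiset.le_add_left r m')
  have h1 := hm'.card_le_order
  have h2 := hr.card_le_order
  have h3 := hm.2.2.1
  have h4 := order_add_le hm'.sum_mem hr.sum_mem
  rw [Multiset.card_add, Multiset.sum_add] at h3
  refine ⟨hm', hm'.sum_mem, by omega, fun t ht hte => ?_⟩
  have h5 := hm.2.2.2 (t + r.sum) (S.add_mem ht hr.sum_mem) (by rw [Multiset.sum_add]; omega)
  have h6 := order_add_le ht hr.sum_mem
  rw [Multiset.card_add] at h5
  omega

theorem IsFreshFactorization.congr {m m' : Multiset ℕ} (hm : S.IsFreshFactorization e m)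
    (hm' : S.IsFactorization m') (hsum : m'.sum = m.sum) (hcard : m'.card = m.card) :
    S.IsFreshFactorization e m' :=
  ⟨hm', by rw [hsum, hcard]; exact hm.2⟩

theorem IsFreshFactorization.add_mem_fresh_two {m : Multiset ℕ} {a b : ℕ}
    (hm : S.IsFreshFactorization e m) (hab : {a, b} ≤ m) : a + b ∈ S.fresh e 2 := by
  simpa using (hm.mono hab).2

theorem IsFreshFactorization.add_mem_fresh_two_of_ne {m : Multiset ℕ} {a b : ℕ}
    (hm : S.IsFreshFactorization e m) (ha : a ∈ m) (hb : b ∈ m) (hab : a ≠ b) :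
    a + b ∈ S.fresh e 2 :=
  hm.add_mem_fresh_two <| (Multiset.le_iff_subset (by simpa using hab)).mpr fun x hx => by
    rcases Multiset.mem_cons.mp hx with rfl | hx
    · exact ha
    · rwa [Multiset.mem_singleton.mp hx]

theorem IsFreshFactorization.add_self_mem_fresh_two {m : Multiset ℕ} {a : ℕ}
    (hm : S.IsFreshFactorization e m) (ha : 2 ≤ m.count a) : a + a ∈ S.fresh e 2 :=
  hm.add_mem_fresh_two (Multiset.le_count_iff_replicate_le.mp ha)

theorem eq_of_ncard_le_three {s : Set ℕ} (hfin : s.Finite) (h : s.ncard ≤ 3) {a b c d : ℕ}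
    (ha : a ∈ s) (hb : b ∈ s) (hc : c ∈ s) (hd : d ∈ s) :
    a = b ∨ a = c ∨ a = d ∨ b = c ∨ b = d ∨ c = d := by
  by_contra! hne
  obtain ⟨h1, h2, h3, h4, h5, h6⟩ := hne
  have h7 : ({a, b, c, d} : Set ℕ).ncard = 4 := by
    rw [Set.ncard_eq_toFinset_card']
    simp [h1, h2, h3, h4, h5, h6]
  have h8 : ({a, b, c, d} : Set ℕ).ncard ≤ s.ncard := by
    refine Set.ncard_le_ncard ?_ hfin
    rintro x (rfl | rfl | rfl | rfl) <;> assumption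
  omega

/-- Four distinct parts would give four distinct pairwise sums. -/
theorem IsFreshFactorization.not_four_distinct (hfin : (S.fresh e 2).Finite)
    (hcard : (S.fresh e 2).ncard ≤ 3) {m : Multiset ℕ} (hm : S.IsFreshFactorization e m)
    {a b c d : ℕ} (ha : a ∈ m) (hb : b ∈ m) (hc : c ∈ m) (hd : d ∈ m) (hab : a ≠ b) (hac : a ≠ c)
    (had : a ≠ d) (hbc : b ≠ c) (hbd : b ≠ d) (hcd : c ≠ d) : False := by
  have sab := hm.add_mem_fresh_two_of_ne ha hb hab
  have sac := hm.add_mem_fresh_two_of_ne ha hc hac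
  have sad := hm.add_mem_fresh_two_of_ne ha hd had
  have h1 := eq_of_ncard_le_three hfin hcard sab sac sad (hm.add_mem_fresh_two_of_ne hb hc hbc)
  have h2 := eq_of_ncard_le_three hfin hcard sab sac sad (hm.add_mem_fresh_two_of_ne hb hd hbd)
  omega

theorem exists_cons_of_lt_card {α : Type*} {m : Multiset α} {k : ℕ} (h : k < m.card) :
    ∃ a m', m = a ::ₘ m' ∧ k ≤ m'.card := by
  obtain ⟨a, ha⟩ := Multiset.card_pos_iff_exists_mem.mp (by omega : 0 < m.card)
  obtain ⟨m', rfl⟩ := Multiset.exists_cons_of_mem ha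
  exact ⟨a, m', rfl, by rw [Multiset.card_cons] at h; omega⟩

/-- The shape of longest factorizations when there are at most three fresh elements of order two
and these are not `2g, g + h, 2h`: up to a change of factorization, all parts but one are equal, or
there are three distinct parts. -/
theorem IsFreshFactorization.shape (hfin : (S.fresh e 2).Finite)
    (hcard : (S.fresh e 2).ncard ≤ 3)
    (hno : ∀ g ∈ S, ∀ h ∈ S, g ≠ h → g + g ∈ S.fresh e 2 → g + h ∈ S.fresh e 2 →
      h + h ∉ S.fresh e 2)
    {m : Multiset ℕ} (hm : S.IsFreshFactorization e m) (h3 : 3 ≤ m.card) :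
    (∃ p q, S.IsFreshFactorization e (q ::ₘ Multiset.replicate (m.card - 1) p) ∧
      m.sum = q + (m.card - 1) * p) ∨
    ∃ a b c, a ≠ b ∧ a ≠ c ∧ b ≠ c ∧ m = {a, b, c} := by
  by_cases hnd : m.Nodup
  · right
    obtain ⟨a, m, rfl, hm1⟩ := exists_cons_of_lt_card h3
    obtain ⟨b, m, rfl, hm2⟩ := exists_cons_of_lt_card hm1
    obtain ⟨c, m, rfl, hm3⟩ := exists_cons_of_lt_card hm2
    simp only [Multiset.nodup_cons, Multiset.mem_cons, not_or] at hnd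
    obtain ⟨⟨hab, hac, ham⟩, ⟨hbc, hbm⟩, hcm, -⟩ := hnd
    rcases Multiset.empty_or_exists_mem m with rfl | ⟨d, hd⟩
    · exact ⟨a, b, c, hab, hac, hbc, rfl⟩
    · exact (hm.not_four_distinct hfin hcard (a := a) (b := b) (c := c) (d := d) (by simp)
        (by simp) (by simp) (by simp [hd]) hab hac (fun h => ham (h ▸ hd)) hbc
        (fun h => hbm (h ▸ hd)) (fun h => hcm (h ▸ hd))).elim
  · left
    obtain ⟨p, hp⟩ : ∃ p, 2 ≤ m.count p := by
      by_contra! h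
      exact hnd (Multiset.nodup_iff_count_le_one.mpr fun p => Nat.le_of_lt_succ (h p))
    have hpp := hm.add_self_mem_fresh_two hp
    have hpm : p ∈ m := Multiset.count_pos.mp (by omega)
    obtain ⟨r, hr⟩ : ∃ r, r = m.filter (¬ · = p) := ⟨_, rfl⟩
    have hmr : Multiset.replicate (m.count p) p + r = m := by
      rw [hr, ← Multiset.filter_eq', Multiset.filter_add_not]
    have hrm : ∀ x ∈ r, x ∈ m ∧ x ≠ p := fun x hx => by
      rw [hr] at hx; exact Multiset.mem_filter.mp hx
    have hrnd : r.Nodup := by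
      refine Multiset.nodup_iff_count_le_one.mpr fun q => not_lt.mp fun hq => ?_
      have hqr : q ∈ r := Multiset.count_pos.mp (by omega)
      have hqm : r.count q ≤ m.count q :=
        Multiset.count_le_of_le q (hmr ▸ Multiset.le_add_left r _)
      exact hno p (hm.1 p hpm).1 q (hm.1 q (hrm q hqr).1).1 (hrm q hqr).2.symm hpp
        (hm.add_mem_fresh_two_of_ne hpm (hrm q hqr).1 (hrm q hqr).2.symm)
        (hm.add_self_mem_fresh_two (by omega))
    have hmc : m.card = m.count p + r.card := by
      conv_lhs => rw [← hmr, Multiset.card_add, Multiset.card_replicate]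
    have hms : m.sum = m.count p * p + r.sum := by
      conv_lhs => rw [← hmr, Multiset.sum_add, Multiset.sum_replicate, smul_eq_mul]
    rcases Multiset.empty_or_exists_mem r with rfl | ⟨a, har⟩
    · have hc : m.count p = (m.card - 1) + 1 := by rw [Multiset.card_zero] at hmc; omega
      rw [hc, Multiset.replicate_succ, add_zero] at hmr
      refine ⟨p, p, by rwa [hmr], ?_⟩
      rw [hms, hc, Multiset.sum_zero]; ring
    obtain ⟨r, rfl⟩ := Multiset.exists_cons_of_mem har
    rcases Multiset.empty_or_exists_mem r with rfl | ⟨b, hbr⟩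
    · have hc : m.count p = m.card - 1 := by simp at hmc; omega
      rw [hc, add_comm, Multiset.cons_add, zero_add] at hmr
      refine ⟨p, a, by rwa [hmr], ?_⟩
      rw [hms, hc, Multiset.sum_cons, Multiset.sum_zero]; ring
    obtain ⟨r, rfl⟩ := Multiset.exists_cons_of_mem hbr
    simp only [Multiset.nodup_cons, Multiset.mem_cons, not_or] at hrnd
    obtain ⟨⟨hab, ha⟩, hb, -⟩ := hrnd
    obtain ⟨ham, hap⟩ := hrm a (by simp)
    obtain ⟨hbm, hbp⟩ := hrm b (by simp)
    rcases Multiset.empty_or_exists_mem r with rfl | ⟨c, hcr⟩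
    · -- the pairwise sums force `2p = a + b`, so `p, …, p, a, b` may be replaced by `p, …, p`
      have h2 := eq_of_ncard_le_three hfin hcard hpp
        (hm.add_mem_fresh_two_of_ne hpm ham hap.symm)
        (hm.add_mem_fresh_two_of_ne hpm hbm hbp.symm) (hm.add_mem_fresh_two_of_ne ham hbm hab)
      have hab2 : a + b = p + p := by omega
      have hc : m.card = (m.card - 1) + 1 := by omega
      have hsum : m.sum = p + (m.card - 1) * p := by
        rw [hms, hmc]
        simp only [Multiset.sum_cons, Multiset.sum_zero, Multiset.card_cons, Multiset.card_zero]
        rw [show m.count p + (0 + 1 + 1) - 1 = m.count p + 1 by omega, add_mul]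
        omega
      refine ⟨p, p, hm.congr (fun x hx => ?_) ?_ ?_, hsum⟩
      · rw [← Multiset.replicate_succ] at hx
        rw [Multiset.eq_of_mem_replicate hx]
        exact hm.1 p hpm
      · rw [hsum, Multiset.sum_cons, Multiset.sum_replicate, smul_eq_mul]
      · rw [Multiset.card_cons, Multiset.card_replicate, ← hc]
    · obtain ⟨hcm, hcp⟩ := hrm c (by simp [hcr])
      exact (hm.not_four_distinct hfin hcard hpm ham hbm hcm hap.symm hbp.symm hcp.symm hab
        (fun h => ha (h ▸ hcr)) (fun h => hb (h ▸ hcr))).elim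

end AddSubmonoid

namespace AddSubmonoid

/-! ### Jumps and fresh elements -/

variable {S : AddSubmonoid ℕ} {e n : ℕ}

theorem mem_apery_of_add {a b : ℕ} (ha : a ∈ S) (hb : b ∈ S) (h : a + b ∈ S.apery e) :
    a ∈ S.apery e :=
  ⟨ha, fun t ht hte => h.2 (t + b) (S.add_mem ht hb) (by omega)⟩

/-- If `2g, g + h, 2h` are the fresh elements of order two, then every fresh element of order at
least two is a combination of `g` and `h`. -/
theorem exists_eq_add_of_mem_fresh {g h : ℕ} (hg : g ∈ S ∧ g ≠ 0) (hh : h ∈ S ∧ h ≠ 0)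
    (h2 : ∀ s ∈ S.fresh e 2, s = g + g ∨ s = g + h ∨ s = h + h) (hn : 2 ≤ n) :
    ∀ s ∈ S.fresh e n, ∃ i j, i + j = n ∧ s = i * g + j * h ∧
      S.IsFreshFactorization e (Multiset.replicate i g + Multiset.replicate j h) := by
  have hfac : ∀ i j, S.IsFactorization (Multiset.replicate i g + Multiset.replicate j h) := by
    intro i j x hx
    rcases Multiset.mem_add.mp hx with hx | hx
    · rwa [Multiset.eq_of_mem_replicate hx]
    · rwa [Multiset.eq_of_mem_replicate hx]
  suffices H : ∀ s ∈ S.fresh e n, ∃ i j, i + j = n ∧ s = i * g + j * h by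
    intro s hs
    obtain ⟨i, j, hij, rfl⟩ := H s hs
    refine ⟨i, j, hij, rfl, hfac i j, ?_⟩
    simpa [hij] using hs
  induction n, hn using Nat.le_induction with
  | base =>
    intro s hs
    rcases h2 s hs with h | h | h
    · exact ⟨2, 0, rfl, by omega⟩
    · exact ⟨1, 1, rfl, by omega⟩
    · exact ⟨0, 2, rfl, by omega⟩
  | succ n hn ih =>
    intro s hs
    obtain ⟨m, hm, rfl, hcard⟩ := exists_freshFactorization hs
    obtain ⟨c, m, rfl, -⟩ := exists_cons_of_lt_card (by omega : n < m.card)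
    rw [Multiset.card_cons, Nat.add_right_cancel_iff] at hcard
    have hm' := hm.mono (Multiset.le_cons_self m c)
    obtain ⟨i, j, hij, hsum⟩ := ih m.sum (hcard ▸ hm'.2)
    -- after exchanging `m` for `i` copies of `g` and `j` copies of `h`, split off one of these
    have hm2 : S.IsFreshFactorization e
        (c ::ₘ (Multiset.replicate i g + Multiset.replicate j h)) := by
      refine hm.congr (fun x hx => ?_) ?_ ?_
      · rcases Multiset.mem_cons.mp hx with rfl | hx
        · exact hm.1 x (by simp)
        · exact hfac i j x hx
      · simp [hsum]
      · simp [hcard, hij]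
    rw [Multiset.sum_cons]
    rcases i with _ | i
    · rcases j with _ | j
      · omega
      · have h3 := (hm2.mono (Multiset.cons_le_cons c (Multiset.le_cons_self
          (Multiset.replicate 0 g + Multiset.replicate j h) h |>.trans (by simp)))).2
        obtain ⟨i', j', hij', h4⟩ := ih (c + j * h) (by
          have : j + 1 = n := by omega
          simpa [this] using h3)
        exact ⟨i', j' + 1, by omega, by rw [hsum]; linarith⟩
    · have h3 := (hm2.mono (Multiset.cons_le_cons c (Multiset.le_cons_self
          (Multiset.replicate i g + Multiset.replicate j h) g |>.trans (by simp)))).2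
      obtain ⟨i', j', hij', h4⟩ := ih (c + (i * g + j * h)) (by
          have : i + j + 1 = n := by omega
          simpa [this] using h3)
      exact ⟨i' + 1, j', by omega, by rw [hsum]; linarith⟩

namespace IsMultiplicity

variable (he : S.IsMultiplicity e)
include he

theorem exists_freshFactorization_of_mem_jumps {x : ℕ} (hx : x ∈ S.jumps e n) :
    ∃ m, S.IsFreshFactorization e m ∧ m.sum = x + e ∧ n + 2 ≤ m.card := by
  obtain ⟨m, hm, hsum, hcard⟩ := exists_freshFactorization (he.add_mem_fresh hx)
  exact ⟨m, hm, hsum, hcard ▸ hx.2.2⟩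

/-- If the fresh elements of order two are at most three and not `2g, g + h, 2h`, there are no more
jumps of order `n` than fresh elements of order `n + 1`. -/
theorem ncard_jumps_le_of_forall_add_self_notMem (hS : IsNumericalSemigroup S)
    (hcard : (S.fresh e 2).ncard ≤ 3)
    (hno : ∀ g ∈ S, ∀ h ∈ S, g ≠ h → g + g ∈ S.fresh e 2 → g + h ∈ S.fresh e 2 →
      h + h ∉ S.fresh e 2)
    (hn : 1 ≤ n) : (S.jumps e n).ncard ≤ (S.fresh e (n + 1)).ncard := by
  have hfin : (S.fresh e 2).Finite := he.finite_apery.subset he.fresh_two_subset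
  by_cases hall : ∀ x ∈ S.jumps e n, ∃ p q k, n + 1 ≤ k ∧
      S.IsFreshFactorization e (q ::ₘ Multiset.replicate k p) ∧ x + e = q + k * p
  · refine he.ncard_jumps_le hS (fun y p => p + p ∈ S.fresh e 2 ∧ ∃ q,
      S.IsFreshFactorization e (q ::ₘ Multiset.replicate (n + 1) p) ∧ y = q + n * p) ?_ ?_
    · rintro y p p' ⟨hp, q, hm, hy⟩ ⟨hp', q', hm', hy'⟩
      by_contra hne
      -- `y + p` is also `q' + n p' + p`, so that `p + p'` is fresh
      have hm2 : S.IsFreshFactorization e (p ::ₘ q' ::ₘ Multiset.replicate n p') := by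
        refine hm.congr (fun x hx => ?_) ?_ (by simp)
        · rcases Multiset.mem_cons.mp hx with rfl | hx
          · exact hm.1 x (by simp)
          · exact hm'.1 x (Multiset.mem_of_le (Multiset.cons_le_cons _
              (Multiset.replicate_mono _ n.le_succ)) hx)
        · simp only [Multiset.sum_cons, Multiset.sum_replicate, smul_eq_mul]
          rw [add_mul]; omega
      refine hno p (hm2.1 p (by simp)).1 p' (hm'.1 p' (by simp)).1 hne hp
        (hm2.add_mem_fresh_two_of_ne (by simp) ?_ hne) hp'
      exact Multiset.mem_cons_of_mem (Multiset.mem_cons_of_mem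
        (Multiset.mem_replicate.mpr ⟨by omega, rfl⟩))
    · intro x hx
      obtain ⟨p, q, k, hk, hm, hxe⟩ := hall x hx
      have hm1 := hm.mono (Multiset.cons_le_cons q (Multiset.replicate_mono p hk))
      refine ⟨q + n * p, ?_, p, (hm1.1 p (by simp)).1, ⟨hm1.add_self_mem_fresh_two ?_, q, hm1, rfl⟩,
        k - n, ?_⟩
      · simpa using (hm1.mono (Multiset.cons_le_cons q (Multiset.replicate_mono p n.le_succ))).2
      · refine le_trans ?_ (Multiset.count_le_count_cons _ _ _)
        rw [Multiset.count_replicate_self]; omega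
      · rw [hxe, add_assoc, ← add_mul, Nat.add_sub_cancel' (by omega)]
  · push Not at hall
    obtain ⟨x₀, hx₀, hbad⟩ := hall
    obtain ⟨m, hm, hsum, hmc⟩ := he.exists_freshFactorization_of_mem_jumps hx₀
    rcases hm.shape hfin hcard hno (by omega) with ⟨p, q, hm', hs⟩ | ⟨a, b, c, hab, hac, hbc, rfl⟩
    · exact absurd (hsum ▸ hs) (hbad p q _ (by omega) hm')
    have hn1 : n = 1 := by simp at hmc; omega
    subst hn1
    simp only [Multiset.insert_eq_cons, Multiset.sum_cons, Multiset.sum_singleton] at hsum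
    have sab := hm.add_mem_fresh_two_of_ne (a := a) (b := b) (by simp) (by simp) hab
    have sac := hm.add_mem_fresh_two_of_ne (a := a) (b := c) (by simp) (by simp) hac
    have sbc := hm.add_mem_fresh_two_of_ne (a := b) (b := c) (by simp) (by simp) hbc
    have hthree {s : ℕ} (hs : s ∈ S.fresh e 2) : s = a + b ∨ s = a + c ∨ s = b + c := by
      have := eq_of_ncard_le_three hfin hcard sab sac sbc hs
      omega
    have key : ∀ x ∈ S.jumps e 1, x = x₀ := by
      intro x hx
      obtain ⟨m', hm', hsum', hmc'⟩ := he.exists_freshFactorization_of_mem_jumps hx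
      rcases hm'.shape hfin hcard hno (by omega) with
        ⟨p, q, hm'', hs⟩ | ⟨a', b', c', hab', hac', hbc', rfl⟩
      · exfalso
        have hpp : p + p ∈ S.fresh e 2 := by
          refine hm''.add_self_mem_fresh_two (le_trans ?_ (Multiset.count_le_count_cons _ _ _))
          rw [Multiset.count_replicate_self]; omega
        have hp : p ∈ S ∧ p ≠ 0 :=
          hm''.1 p (Multiset.mem_cons_of_mem (Multiset.mem_replicate.mpr ⟨by omega, rfl⟩))
        have h4 := hthree hpp
        have aux : ∀ d ∈ ({a, b, c} : Multiset ℕ), d + 2 * p ≠ a + b + c := by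
          intro d hd hdp
          refine hbad p d 2 le_rfl (hm.congr (fun y hy => ?_) ?_ (by simp)) (by omega)
          · rcases Multiset.mem_cons.mp hy with rfl | hy
            · exact hm.1 y hd
            · rwa [Multiset.eq_of_mem_replicate hy]
          · simp only [Multiset.sum_cons, Multiset.sum_replicate, smul_eq_mul,
              Multiset.insert_eq_cons, Multiset.sum_singleton]
            omega
        have ha := aux a (by simp)
        have hb := aux b (by simp)
        have hc := aux c (by simp)
        omega
      · simp only [Multiset.insert_eq_cons, Multiset.sum_cons, Multiset.sum_singleton] at hsum'
        have h1 := hthree (hm'.add_mem_fresh_two_of_ne (a := a') (b := b') (by simp) (by simp) hab')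
        have h2 := hthree (hm'.add_mem_fresh_two_of_ne (a := a') (b := c') (by simp) (by simp) hac')
        have h3 := hthree (hm'.add_mem_fresh_two_of_ne (a := b') (b := c') (by simp) (by simp) hbc')
        clear hthree
        rcases h1 with h1 | h1 | h1 <;> rcases h2 with h2 | h2 | h2 <;>
          rcases h3 with h3 | h3 | h3 <;> omega
    have h1 : (S.jumps e 1).ncard ≤ 1 := by
      refine le_of_le_of_eq ?_ (Set.ncard_singleton x₀)
      exact Set.ncard_le_ncard (t := {x₀}) key
    exact h1.trans ((Set.ncard_pos hfin).mpr ⟨_, sab⟩)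

/-- The case in which `2g, g + h, 2h` are the fresh elements of order two and `2g + h` is the
largest element of the Apéry set. -/
theorem ncard_jumps_le_of_eq {g h : ℕ} (hS : IsNumericalSemigroup S) (hne : g ≠ h)
    (hg : g ∈ S.apery e ∧ g ≠ 0) (hh : h ∈ S ∧ h ≠ 0)
    (h2 : ∀ s ∈ S.fresh e 2, s = g + g ∨ s = g + h ∨ s = h + h)
    (hsym : ∀ w ∈ S.apery e, ∃ w' ∈ S, w + w' = g + g + h)
    (hW : g + g + h ∈ S.apery e)
    (hap : ∀ s ∈ S.apery e, S.order s = 3 → s = g + g + h) (hn : 1 ≤ n) :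
    (S.jumps e n).ncard ≤ (S.fresh e (n + 1)).ncard := by
  have hrep {x : ℕ} (hx : x ∈ S.jumps e n) : ∃ i j, n + 2 ≤ i + j ∧ x + e = i * g + j * h ∧
      S.IsFreshFactorization e (Multiset.replicate i g + Multiset.replicate j h) := by
    obtain ⟨i, j, hij, h3, h4⟩ := exists_eq_add_of_mem_fresh ⟨hg.1.1, hg.2⟩ hh h2
      (by have := hx.2.2; omega) _ (he.add_mem_fresh hx)
    exact ⟨i, j, by have := hx.2.2; omega, h3, h4⟩
  have hsub {i j i' j' : ℕ}
      (hm : S.IsFreshFactorization e (Multiset.replicate i g + Multiset.replicate j h))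
      (hi : i' ≤ i) (hj : j' ≤ j) : i' * g + j' * h ∈ S.fresh e (i' + j') := by
    simpa using (hm.mono (add_le_add (Multiset.replicate_mono g hi)
      (Multiset.replicate_mono h hj))).2
  -- a fresh element of order three other than `2g + h` is `x + e` with `2g + h - x` in `S`
  have hdual {s : ℕ} (hs : s ∈ S.fresh e 3) (hsW : s ≠ g + g + h) (hse : 2 * e < s) :
      ∃ x x', x' ∈ S.apery e ∧ x + e = s ∧ x + x' = g + g + h := by
    have hnot : s ∉ S.apery e := fun h' => hsW (hap s h' hs.2.1)
    obtain ⟨x, hx, hxe⟩ : ∃ x ∈ S, x + e = s := by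
      by_contra! h'
      exact hnot ⟨hs.1, h'⟩
    have hx1 := hs.2.2 x hx hxe
    have hxap : x ∈ S.apery e := by
      refine ⟨hx, fun t ht hte => ?_⟩
      have h3 := he.order_succ_le ht
      rw [hte] at h3
      have ht0 : t = 0 := by
        by_contra h0
        have := one_le_order ht h0
        omega
      omega
    obtain ⟨x', hx', hxx'⟩ := hsym x hxap
    exact ⟨x, x', mem_apery_of_add hx' hx (by rwa [add_comm, hxx']), hxe, hxx'⟩
  have hge := he.lt_of_mem_apery hg.1 hg.2
  have hhe := he.le h hh.1 hh.2
  have hnot : 3 * g + 0 * h ∈ S.fresh e (3 + 0) → 1 * g + 2 * h ∉ S.fresh e (1 + 2) := by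
    intro h3 h12
    obtain ⟨x, x', hx', hxe, hxx'⟩ := hdual h3 (by omega) (by omega)
    obtain ⟨y, y', hy', hye, hyy'⟩ := hdual h12 (by omega) (by omega)
    -- `x' + y' = 2e`, while nonzero elements of the Apéry set exceed `e`
    have h2e : x' + y' = e + e := by omega
    have hx0 : x' ≠ 0 := fun h0 => hy'.2 e he.mem (by omega)
    have hy0 : y' ≠ 0 := fun h0 => hx'.2 e he.mem (by omega)
    have := he.lt_of_mem_apery hx' hx0
    have := he.lt_of_mem_apery hy' hy0
    omega
  by_cases h12 : 1 * g + 2 * h ∈ S.fresh e (1 + 2)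
  · refine he.ncard_jumps_le hS (fun _ p => p = h) (fun _ _ _ h h' => h.trans h'.symm) ?_
    intro x hx
    obtain ⟨i, j, hij, hxe, hm⟩ := hrep hx
    have hi : i ≤ 2 := by
      by_contra! hi
      exact hnot (hsub hm hi (Nat.zero_le j)) h12
    refine ⟨i * g + (n + 1 - i) * h, ?_, h, hh.1, rfl, i + j - (n + 1), ?_⟩
    · have := hsub hm le_rfl (show n + 1 - i ≤ j by omega)
      rwa [Nat.add_sub_cancel' (by omega)] at this
    · rw [hxe, add_assoc, ← add_mul]
      congr 2; omega
  · have hadd : (n + 1) * g ≠ (n + 1) * h := fun h' =>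
      hne (Nat.eq_of_mul_eq_mul_left n.succ_pos h')
    refine he.ncard_jumps_le hS
      (fun y p => y ≠ (n + 1) * h ∧ p = g ∨ y = (n + 1) * h ∧ p = h) ?_ ?_
    · rintro y p p' (⟨h3, rfl⟩ | ⟨h3, rfl⟩) (⟨h4, rfl⟩ | ⟨h4, rfl⟩)
      · rfl
      · exact absurd h4 h3
      · exact absurd h3 h4
      · rfl
    intro x hx
    obtain ⟨i, j, hij, hxe, hm⟩ := hrep hx
    rcases Nat.eq_zero_or_pos i with rfl | hi
    · refine ⟨(n + 1) * h, ?_, h, hh.1, Or.inr ⟨rfl, rfl⟩, j - (n + 1), ?_⟩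
      · simpa using hsub hm le_rfl (show n + 1 ≤ j by omega)
      · rw [hxe, zero_mul, zero_add, ← add_mul]
        congr 1; omega
    · have hj : j ≤ 1 := by
        by_contra! hj
        exact h12 (hsub hm hi hj)
      refine ⟨(n + 1 - j) * g + j * h, ?_, g, hg.1.1, Or.inl ⟨fun h' => hne ?_, rfl⟩,
        i + j - (n + 1), ?_⟩
      · have := hsub hm (show n + 1 - j ≤ i by omega) le_rfl
        rwa [Nat.sub_add_cancel (by omega)] at this
      · have h3 : n + 1 = (n + 1 - j) + j := by omega
        rw [h3, add_mul, Nat.add_sub_cancel] at h'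
        exact Nat.eq_of_mul_eq_mul_left (by omega) (Nat.add_right_cancel h')
      · rw [hxe, add_right_comm, ← add_mul]
        congr 2; omega

/-- A symmetric numerical semigroup with `e ≤ v + 4` has no more jumps of order `n` than fresh
elements of order `n + 1`. Symmetry is stated as the duality `w ↦ W - w` of the Apéry set. -/
theorem ncard_jumps_le_of_symmetric (hS : IsNumericalSemigroup S)
    (hv : e ≤ semigroupEmbeddingDimension S + 4) {W : ℕ} (hW : W ∈ S.apery e)
    (hsym : ∀ w ∈ S.apery e, ∃ w' ∈ S, w + w' = W) (n : ℕ) :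
    (S.jumps e n).ncard ≤ (S.fresh e (n + 1)).ncard := by
  rcases Nat.eq_zero_or_pos n with rfl | hn
  · have : S.jumps e 0 = ∅ := by
      refine Set.eq_empty_of_forall_notMem fun x hx => ?_
      have hx0 : x = 0 := by
        by_contra h0
        have := one_le_order hx.1 h0
        have := hx.2.1
        omega
      have h1 := hx.2.2
      rw [hx0, zero_add, zero_add, he.order_eq_one] at h1
      omega
    rw [this, Set.ncard_empty]
    exact Nat.zero_le _
  obtain ⟨T, hT⟩ : ∃ T, T = {s ∈ S.apery e | 2 ≤ S.order s} := ⟨_, rfl⟩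
  have hTcard : T.ncard ≤ 4 := by
    have := he.ncard_apery_two_le_order_add_le
    rw [← hT] at this
    omega
  have hTfin : T.Finite := hT ▸ he.finite_apery.subset (Set.sep_subset _ _)
  have h2T : S.fresh e 2 ⊆ T := fun s hs =>
    hT ▸ ⟨he.fresh_two_subset hs, hs.2.1.ge⟩
  have hfin := hTfin.subset h2T
  have hdvd {a b : ℕ} (ha : a ∈ S) (hb : b ∈ S) (hab : a + b = W) : a ∈ S.apery e :=
    mem_apery_of_add ha hb (hab ▸ hW)
  have hW3 {s s' : ℕ} (hs : s ∈ S.fresh e 2) (hs' : s' ∈ S.fresh e 2) (hne : s ≠ s') :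
      3 ≤ S.order W := by
    obtain ⟨s, hs, hsW⟩ : ∃ s ∈ S.fresh e 2, s ≠ W := by
      by_cases h : s = W
      · exact ⟨s', hs', fun h' => hne (h.trans h'.symm)⟩
      · exact ⟨s, hs, h⟩
    obtain ⟨w, hw, hsw⟩ := hsym s (he.fresh_two_subset hs)
    have h1 := order_add_le hs.1 hw
    have h2 := one_le_order hw (by omega)
    rw [hsw, hs.2.1] at h1
    omega
  have hins (h3 : 3 ≤ S.order W) : (S.fresh e 2).ncard + 1 ≤ T.ncard ∧
      insert W (S.fresh e 2) ⊆ T := by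
    have hsub : insert W (S.fresh e 2) ⊆ T :=
      Set.insert_subset (hT ▸ ⟨hW, by omega⟩) h2T
    have hWn : W ∉ S.fresh e 2 := fun h => by have := h.2.1; omega
    rw [← Set.ncard_insert_of_notMem hWn hfin]
    exact ⟨Set.ncard_le_ncard hsub hTfin, hsub⟩
  have hcard : (S.fresh e 2).ncard ≤ 3 := by
    by_contra! hlt
    obtain ⟨s, hs, s', hs', hne⟩ := (Set.one_lt_ncard hfin).mp (by omega)
    have := (hins (hW3 hs hs' hne)).1
    omega
  by_cases hno : ∀ g ∈ S, ∀ h ∈ S, g ≠ h → g + g ∈ S.fresh e 2 → g + h ∈ S.fresh e 2 →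
      h + h ∉ S.fresh e 2
  · exact he.ncard_jumps_le_of_forall_add_self_notMem hS hcard hno hn
  push Not at hno
  obtain ⟨g, hg, h, hh, hne, hgg, hgh, hhh⟩ := hno
  have h3 := hW3 hgg hgh (by omega)
  have h2 : ∀ s ∈ S.fresh e 2, s = g + g ∨ s = g + h ∨ s = h + h := fun s hs => by
    have := eq_of_ncard_le_three hfin hcard hgg hgh hhh hs
    omega
  -- the elements `2g, g + h, 2h, W` exhaust those of order at least two in the Apéry set
  have hTeq : ∀ s ∈ S.apery e, 2 ≤ S.order s → s = W ∨ s ∈ S.fresh e 2 := by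
    have h3' : 3 ≤ (S.fresh e 2).ncard := by
      have hsub : ({g + g, g + h, h + h} : Set ℕ) ⊆ S.fresh e 2 := by
        rintro x (rfl | rfl | rfl) <;> assumption
      have := Set.ncard_le_ncard hsub hfin
      rwa [Set.ncard_eq_toFinset_card', show ({g + g, g + h, h + h} : Set ℕ).toFinset.card = 3 by
        rw [Set.toFinset_insert, Set.toFinset_insert, Set.toFinset_singleton]
        refine Finset.card_eq_three.mpr ⟨_, _, _, ?_, ?_, ?_, rfl⟩ <;> omega] at this
    have hWn : W ∉ S.fresh e 2 := fun h => by have := h.2.1; omega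
    have heq : insert W (S.fresh e 2) = T := by
      refine Set.eq_of_subset_of_ncard_le (hins h3).2 ?_ hTfin
      rw [Set.ncard_insert_of_notMem hWn hfin]
      omega
    intro s hs hs2
    have : s ∈ T := hT ▸ ⟨hs, hs2⟩
    rwa [← heq] at this
  have hW3 : S.order W = 3 := by
    obtain ⟨a, ha, ha0, b, hb, hb1, hab⟩ :=
      exists_add_of_succ_le_order hW.1 (n := S.order W - 1) (by omega)
    rcases hTeq b (hdvd hb ha (by omega)) (by omega) with hbW | hb2
    · rw [show a = 0 by omega, order_zero] at ha0
      omega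
    · have := hb2.2.1
      omega
  have hne0 {x : ℕ} (hx : x + x ∈ S.fresh e 2) : x ≠ 0 := fun h0 => by
    have := hx.2.1
    rw [h0, order_zero] at this
    omega
  have hg0 := hne0 hgg
  have hh0 := hne0 hhh
  -- if `W = 2x + p`, then `x + p` has order two
  have hquot {x : ℕ} (hx : x ∈ S) (hx0 : x ≠ 0) (hxx : x + x ∈ S.fresh e 2) :
      ∃ c ∈ S.fresh e 2, x + c = W := by
    obtain ⟨p, hp, hpW⟩ := hsym _ (he.fresh_two_subset hxx)
    have hp0 : p ≠ 0 := fun h0 => by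
      have := hxx.2.1
      rw [h0, add_zero] at hpW
      rw [hpW] at this
      omega
    refine ⟨x + p, ?_, by omega⟩
    rcases hTeq (x + p) (hdvd (S.add_mem hx hp) hx (by omega)) (two_le_order_add hx hp hx0 hp0)
      with h' | h'
    · omega
    · exact h'
  have hWgh : W = g + g + h ∨ W = h + h + g := by
    obtain ⟨i, j, hij, hW', -⟩ := exists_eq_add_of_mem_fresh ⟨hg, hg0⟩ ⟨hh, hh0⟩ h2
      (by omega : 2 ≤ S.order W) W (mem_fresh_of_mem_apery hW)
    obtain ⟨c, hc, hcW⟩ := hquot hg hg0 hgg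
    obtain ⟨d, hd, hdW⟩ := hquot hh hh0 hhh
    have hc2 := h2 c hc
    have hd2 := h2 d hd
    omega
  have hap : ∀ s ∈ S.apery e, S.order s = 3 → s = W := fun s hs hs3 =>
    (hTeq s hs (by omega)).resolve_right fun h' => by have := h'.2.1; omega
  rcases hWgh with rfl | rfl
  · exact he.ncard_jumps_le_of_eq hS hne
      ⟨mem_apery_of_add hg hg (he.fresh_two_subset hgg), hg0⟩ ⟨hh, hh0⟩ h2 hsym hW hap hn
  · refine he.ncard_jumps_le_of_eq hS hne.symm
      ⟨mem_apery_of_add hh hh (he.fresh_two_subset hhh), hh0⟩ ⟨hg, hg0⟩ (fun s hs => ?_) hsym hW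
      hap hn
    have := h2 s hs
    omega

end IsMultiplicity

end AddSubmonoid

section Socle

open CategoryTheory Abelian IsLocalRing

/-! ### Vanishing of `Ext` along short exact sequences -/

section Abelian

universe w v u'

variable {C : Type u'} [Category.{v} C] [Abelian C] [HasExt.{w} C] {X Y Z A : C} {f : X ⟶ Y}
  {g : Y ⟶ Z} {zero : f ≫ g = 0} {i : ℕ}

theorem ext_eq_zero_of_shortExact₂ (hS : (ShortComplex.mk f g zero).ShortExact)
    (hX : ∀ α : Ext X A i, α = 0) (hZ : ∀ α : Ext Z A i, α = 0) (α : Ext Y A i) : α = 0 := by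
  obtain ⟨β, hβ⟩ := Ext.contravariant_sequence_exact₂ hS A α (hX _)
  rw [← hβ, hZ β, Ext.comp_zero]

theorem ext_eq_zero_of_shortExact₁ (hS : (ShortComplex.mk f g zero).ShortExact)
    (hY : ∀ α : Ext Y A i, α = 0) (hZ : ∀ α : Ext Z A (i + 1), α = 0) (α : Ext X A i) :
    α = 0 := by
  obtain ⟨β, hβ⟩ := Ext.contravariant_sequence_exact₁ hS A α (n₁ := i + 1) (by omega) (hZ _)
  rw [← hβ, hY β, Ext.comp_zero]

theorem ext_eq_zero_of_shortExact₃ (hS : (ShortComplex.mk f g zero).ShortExact)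
    (hX : ∀ α : Ext X A i, α = 0) (hY : ∀ α : Ext Y A (i + 1), α = 0) (α : Ext Z A (i + 1)) :
    α = 0 := by
  obtain ⟨β, hβ⟩ := Ext.contravariant_sequence_exact₃ hS A α (hY _) (n₀ := i) (by omega)
  rw [← hβ, hX β, Ext.comp_zero]

/-- Let `P → P → A` and `K → A → B` be short exact with `P` projective, `Hom(K, P) = 0` and
`Ext²(B, P) = 0`. If every endomorphism of `P` commutes with the given one, then every morphism
`K → A` extends to an endomorphism of `A` induced by an endomorphism of `P`. -/
theorem exists_extension_of_ext_two_eq_zero {P K B : C} [Projective P] {x : P ⟶ P} {q : P ⟶ A}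
    {zero : x ≫ q = 0} (hS : (ShortComplex.mk x q zero).ShortExact) {j : K ⟶ A} {p : A ⟶ B}
    {zero' : j ≫ p = 0} (hT : (ShortComplex.mk j p zero').ShortExact)
    (hP : ∀ φ : K ⟶ P, φ = 0) (hB : ∀ α : Ext B P 2, α = 0)
    (hcomm : ∀ γ : P ⟶ P, x ≫ γ = γ ≫ x) (φ : K ⟶ A) :
    ∃ (γ : P ⟶ P) (η : A ⟶ A), q ≫ η = γ ≫ q ∧ j ≫ η = φ := by
  -- the class `φ δ`, with `δ` the class of the first sequence, extends along `j` to `δ γ`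
  obtain ⟨ψ, hψ⟩ := Ext.contravariant_sequence_exact₁ hT P
    ((Ext.mk₀ φ).comp hS.extClass (zero_add 1)) (n₁ := 2) rfl (hB _)
  obtain ⟨γ, hγ⟩ := Ext.contravariant_sequence_exact₃ hS P ψ
    (Ext.eq_zero_of_projective _) (n₀ := 0) rfl
  obtain ⟨γ, rfl⟩ := Ext.homEquiv₀.symm.surjective γ
  rw [Ext.homEquiv₀_symm_apply] at hγ
  have hdesc : x ≫ (γ ≫ q) = 0 := by rw [← Category.assoc, hcomm, Category.assoc, zero,
    Limits.comp_zero]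
  have : Epi q := hS.epi_g
  obtain ⟨η, hη⟩ : ∃ η : A ⟶ A, q ≫ η = γ ≫ q :=
    ⟨hS.exact.desc (γ ≫ q) hdesc, hS.exact.g_desc _ hdesc⟩
  have hnat := ShortComplex.ShortExact.extClass_naturality hS hS
    { τ₁ := γ, τ₂ := γ, τ₃ := η, comm₁₂ := (hcomm γ).symm, comm₂₃ := hη.symm }
  refine ⟨γ, η, hη, ?_⟩
  -- `(j η - φ) δ = 0`, so that `j η - φ` lifts to `K → P`
  have hzero : (Ext.mk₀ (j ≫ η - φ)).comp hS.extClass (zero_add 1) = 0 := by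
    rw [sub_eq_add_neg, Ext.mk₀_add, Ext.mk₀_neg, Ext.add_comp, Ext.neg_comp, ← sub_eq_add_neg,
      sub_eq_zero, ← hψ, ← hγ]
    erw [hnat]
    rw [Ext.mk₀_comp_mk₀_assoc]
  obtain ⟨β, hβ⟩ := Ext.covariant_sequence_exact₃ K hS _ rfl hzero
  obtain ⟨β, rfl⟩ := Ext.homEquiv₀.symm.surjective β
  have hβ0 : β = 0 := hP β
  rw [hβ0, Ext.homEquiv₀_symm_apply, Ext.mk₀_zero, Ext.zero_comp] at hβ
  rw [← sub_eq_zero]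
  apply Ext.homEquiv₀.symm.injective
  rw [Ext.homEquiv₀_symm_apply, Ext.homEquiv₀_symm_apply, Ext.mk₀_zero, hβ]

end Abelian

/-! ### The socle of `R / x` for a local ring `R` of finite injective dimension -/

variable {R : Type u} [CommRing R]

theorem shortExact_ofHom {X Y Z : Type u} [AddCommGroup X] [AddCommGroup Y] [AddCommGroup Z]
    [Module R X] [Module R Y] [Module R Z] {f : X →ₗ[R] Y} {g : Y →ₗ[R] Z}
    (hf : Function.Injective f) (hfg : Function.Exact f g) (hg : Function.Surjective g) :
    (ShortComplex.mk (ModuleCat.ofHom f) (ModuleCat.ofHom g)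
      (ModuleCat.hom_ext hfg.linearMap_comp_eq_zero)).ShortExact where
  exact := (ShortComplex.ShortExact.moduleCat_exact_iff_function_exact _).mpr hfg
  mono_f := (ModuleCat.mono_iff_injective _).mpr hf
  epi_g := (ModuleCat.epi_iff_surjective _).mpr hg

theorem exact_mulLeft_mkQ (x : R) :
    Function.Exact (LinearMap.mulLeft R x) (Ideal.span {x}).mkQ := fun a => by
  rw [Submodule.mkQ_apply, Submodule.Quotient.mk_eq_zero, Ideal.mem_span_singleton']
  exact exists_congr fun b => by rw [LinearMap.mulLeft_apply, mul_comm]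

theorem mulLeft_injective_of_mem_nonZeroDivisors {x : R} (hx : x ∈ nonZeroDivisors R) :
    Function.Injective (LinearMap.mulLeft R x) := fun _ _ hab =>
  (mul_cancel_left_mem_nonZeroDivisors hx).mp hab

/-- `Ext^i(M, R)` vanishes for all `R`-modules `M` of finite length. -/
def ExtVanishesOnFiniteLength (R : Type u) [CommRing R] (i : ℕ) : Prop :=
  ∀ (M : Type u) [AddCommGroup M] [Module R M], IsFiniteLength R M →
    ∀ α : Ext (ModuleCat.of R M) (ModuleCat.of R R) i, α = 0

theorem ext_quotient_span_eq_zero {x : R} (hx : x ∈ nonZeroDivisors R) {i : ℕ} (hi : 2 ≤ i)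
    (α : Ext (ModuleCat.of R (R ⧸ Ideal.span {x})) (ModuleCat.of R R) i) : α = 0 := by
  obtain ⟨i, rfl⟩ := Nat.exists_eq_add_of_le' hi
  exact ext_eq_zero_of_shortExact₃ (shortExact_ofHom (mulLeft_injective_of_mem_nonZeroDivisors hx)
    (exact_mulLeft_mkQ x) (Submodule.mkQ_surjective _)) (fun β => Ext.eq_zero_of_projective β)
    (fun β => Ext.eq_zero_of_projective β) α

variable [IsLocalRing R]

/-- By dévissage, it suffices to consider the residue field. -/
theorem extVanishesOnFiniteLength_of_residueField {i : ℕ}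
    (h : ∀ α : Ext (ModuleCat.of R (R ⧸ maximalIdeal R)) (ModuleCat.of R R) i, α = 0) :
    ExtVanishesOnFiniteLength R i := by
  intro M _ _ hM
  induction hM with
  | @of_subsingleton M _ _ _ =>
    intro α
    have : Limits.IsZero (ModuleCat.of R M) := ModuleCat.isZero_of_subsingleton _
    rw [← α.mk₀_id_comp, this.eq_of_src (𝟙 _) 0, Ext.mk₀_zero, Ext.zero_comp]
  | @of_simple_quotient M _ _ N hs _ ih =>
    obtain ⟨I, hI, ⟨φ⟩⟩ := isSimpleModule_iff_quot_maximal.mp hs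
    obtain rfl := eq_maximalIdeal hI
    exact ext_eq_zero_of_shortExact₂ (shortExact_ofHom (f := N.subtype)
      (g := φ.toLinearMap ∘ₗ N.mkQ) N.injective_subtype (fun a => by simp)
      (φ.surjective.comp N.mkQ_surjective)) ih h

/-- The map from the residue field to `R / I` given by a socle element `u`. -/
def socleMap (I : Ideal R) (u : R) (hu : ∀ a ∈ maximalIdeal R, a * u ∈ I) :
    (R ⧸ maximalIdeal R) →ₗ[R] R ⧸ I :=
  (maximalIdeal R).liftQ (I.mkQ ∘ₗ LinearMap.mulRight R u) fun a ha =>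
    (Submodule.Quotient.mk_eq_zero I).mpr (hu a ha)

theorem socleMap_mk (I : Ideal R) (u : R) (hu : ∀ a ∈ maximalIdeal R, a * u ∈ I) (a : R) :
    socleMap I u hu (Submodule.Quotient.mk a) = Submodule.Quotient.mk (a * u) := rfl

theorem socleMap_injective {I : Ideal R} {u : R} (hu : ∀ a ∈ maximalIdeal R, a * u ∈ I)
    (huI : u ∉ I) : Function.Injective (socleMap I u hu) := by
  rw [injective_iff_map_eq_zero]
  intro a ha
  obtain ⟨a, rfl⟩ := Submodule.Quotient.mk_surjective _ a
  rw [socleMap_mk, Submodule.Quotient.mk_eq_zero] at ha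
  rw [Submodule.Quotient.mk_eq_zero, mem_maximalIdeal, mem_nonunits_iff]
  exact fun hunit => huI ((Ideal.unit_mul_mem_iff_mem I hunit).mp ha)

theorem exact_socleMap_mkQ {I : Ideal R} {u : R} (hu : ∀ a ∈ maximalIdeal R, a * u ∈ I) :
    Function.Exact (socleMap I u hu) (LinearMap.range (socleMap I u hu)).mkQ :=
  LinearMap.exact_iff.mpr (Submodule.ker_mkQ _)

/-- Vanishing of `Ext` descends to degree two, because `Ext^i(R / x, R)` vanishes for `i ≥ 2` and
the residue field embeds into `R / x`. -/
theorem extVanishesOnFiniteLength_two {x u : R} (hx : x ∈ nonZeroDivisors R)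
    (hfl : IsFiniteLength R (R ⧸ Ideal.span {x}))
    (hu : ∀ a ∈ maximalIdeal R, a * u ∈ Ideal.span {x}) (hux : u ∉ Ideal.span {x})
    {n : ℕ} (hn : HasInjectiveDimensionLE (ModuleCat.of R R) n) :
    ExtVanishesOnFiniteLength R 2 := by
  have hstep : ∀ i, 2 ≤ i → ExtVanishesOnFiniteLength R (i + 1) →
      ExtVanishesOnFiniteLength R i := fun i hi h =>
    extVanishesOnFiniteLength_of_residueField (ext_eq_zero_of_shortExact₁
      (shortExact_ofHom (socleMap_injective hu hux) (exact_socleMap_mkQ hu)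
        (Submodule.mkQ_surjective _))
      (ext_quotient_span_eq_zero hx hi) (h _ (hfl.of_surjective (Submodule.mkQ_surjective _))))
  have hdesc : ∀ j, ExtVanishesOnFiniteLength R (2 + j) → ExtVanishesOnFiniteLength R 2 := by
    intro j
    induction j with
    | zero => exact id
    | succ j ih => exact fun h => ih (hstep _ (by omega) h)
  exact hdesc n fun M _ _ _ α => α.eq_zero_of_hasInjectiveDimensionLT (n + 1) (by omega)

/-- Let `R` be a local ring of finite injective dimension and `x` a nonzerodivisor in its maximal
ideal such that `R / x` has finite length. Then the socle of `R / x` is generated by any of its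
nonzero elements. -/
theorem exists_mul_sub_mem_of_socle {x u v : R} (hx : x ∈ nonZeroDivisors R)
    (hxm : x ∈ maximalIdeal R) (hfl : IsFiniteLength R (R ⧸ Ideal.span {x}))
    (hu : ∀ a ∈ maximalIdeal R, a * u ∈ Ideal.span {x}) (hux : u ∉ Ideal.span {x})
    (hv : ∀ a ∈ maximalIdeal R, a * v ∈ Ideal.span {x})
    {n : ℕ} (hn : HasInjectiveDimensionLE (ModuleCat.of R R) n) :
    ∃ c : R, c * u - v ∈ Ideal.span {x} := by
  have h2 := extVanishesOnFiniteLength_two hx hfl hu hux hn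
  have hP : ∀ φ : ModuleCat.of R (R ⧸ maximalIdeal R) ⟶ ModuleCat.of R R, φ = 0 := by
    refine fun φ => ModuleCat.hom_ext (LinearMap.ext fun a => ?_)
    obtain ⟨a, rfl⟩ := Submodule.Quotient.mk_surjective _ a
    refine (mul_cancel_left_mem_nonZeroDivisors hx).mp ?_
    have h1 := φ.hom.map_smul x (Submodule.Quotient.mk a)
    rw [← Submodule.Quotient.mk_smul, (Submodule.Quotient.mk_eq_zero _).mpr
      (show x • a ∈ _ from Ideal.mul_mem_right a _ hxm), map_zero] at h1
    exact h1.symm.trans (mul_zero x).symm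
  have hcomm : ∀ γ : ModuleCat.of R R ⟶ ModuleCat.of R R,
      ModuleCat.ofHom (LinearMap.mulLeft R x) ≫ γ = γ ≫ ModuleCat.ofHom (LinearMap.mulLeft R x) :=
    fun γ => ModuleCat.hom_ext (LinearMap.ext fun a => γ.hom.map_smul x a)
  obtain ⟨γ, η, hη, hφ⟩ := exists_extension_of_ext_two_eq_zero
    (shortExact_ofHom (mulLeft_injective_of_mem_nonZeroDivisors hx) (exact_mulLeft_mkQ x)
      (Submodule.mkQ_surjective _))
    (shortExact_ofHom (socleMap_injective hu hux) (exact_socleMap_mkQ hu)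
      (Submodule.mkQ_surjective _))
    hP (h2 _ (hfl.of_surjective (Submodule.mkQ_surjective _))) hcomm
    (ModuleCat.ofHom (socleMap _ v hv))
  have h1 : η.hom (Submodule.Quotient.mk (1 * u)) = Submodule.Quotient.mk (1 * v) :=
    congr($hφ (Submodule.Quotient.mk (1 : R)))
  have h3 : η.hom (Submodule.Quotient.mk u) = Submodule.Quotient.mk (γ.hom u) :=
    congr($hη u)
  have h4 : γ.hom u = u * γ.hom (1 : R) := by
    have h := γ.hom.map_smul u (1 : R)
    have h' : u • (1 : R) = u := mul_one u
    exact (congrArg γ.hom h'.symm).trans h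
  refine ⟨γ.hom (1 : R), ?_⟩
  rw [one_mul, one_mul, h3, h4] at h1
  rw [mul_comm]
  exact (Submodule.Quotient.eq _).mp h1

end Socle

section SemigroupRing

open IsLocalRing

set_option synthInstance.maxHeartbeats 400000

variable {k : Type u} [Field k] {S : AddSubmonoid ℕ}

/-! ### Ideals of `k[[S]]` described by exponents -/

/-- The Hilbert function of a local ring can be computed by a surjection of the `n`-th power of the
maximal ideal onto a space of functions that is semilinear with respect to a residue map. -/
theorem hilbertFunction_eq_card {R : Type u} [CommRing R] [IsLocalRing R] {K : Type u} [Field K]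
    {π : R →+* K} (hπ : Function.Surjective π) (hπm : ∀ r, π r = 0 ↔ r ∈ maximalIdeal R) {n : ℕ}
    {ι : Type} [Fintype ι] {φ : ↥(maximalIdeal R ^ n) →+ (ι → K)} (hφ : Function.Surjective φ)
    (hsmul : ∀ (r : R) (a : ↥(maximalIdeal R ^ n)), φ (r • a) = π r • φ a)
    (hker : ∀ a : ↥(maximalIdeal R ^ n), φ a = 0 ↔ (a : R) ∈ maximalIdeal R ^ (n + 1)) :
    hilbertFunction R n = Fintype.card ι := by
  have hker' : ∀ a, φ a = 0 ↔
      a ∈ (maximalIdeal R • ⊤ : Submodule R ↥(maximalIdeal R ^ n)) := fun a => by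
    rw [hker, Submodule.mem_smul_top_iff, smul_eq_mul, ← pow_succ']
  let N : Submodule R ↥(maximalIdeal R ^ n) := maximalIdeal R • ⊤
  let ψ : (↥(maximalIdeal R ^ n) ⧸ N) →+ (ι → K) :=
    QuotientAddGroup.lift N.toAddSubgroup φ fun a ha => (hker' a).mpr ha
  have hψ : Function.Bijective ψ := by
    constructor
    · rw [injective_iff_map_eq_zero]
      intro a ha
      obtain ⟨a, rfl⟩ := Submodule.Quotient.mk_surjective _ a
      exact (Submodule.Quotient.mk_eq_zero _).mpr ((hker' a).mp ha)
    · intro c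
      obtain ⟨a, ha⟩ := hφ c
      exact ⟨Submodule.Quotient.mk a, ha⟩
  let ρ : (R ⧸ maximalIdeal R) →+* K :=
    Ideal.Quotient.lift _ π fun a ha => (hπm a).mpr ha
  have hρ : Function.Bijective ρ := by
    constructor
    · rw [injective_iff_map_eq_zero]
      intro a ha
      obtain ⟨a, rfl⟩ := Ideal.Quotient.mk_surjective a
      exact Ideal.Quotient.eq_zero_iff_mem.mpr ((hπm a).mp ha)
    · intro c
      obtain ⟨r, hr⟩ := hπ c
      exact ⟨Ideal.Quotient.mk _ r, hr⟩
  have hrank := rank_eq_of_equiv_equiv ρ (AddEquiv.ofBijective ψ hψ) hρ (fun r a => by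
    obtain ⟨r, rfl⟩ := Ideal.Quotient.mk_surjective r
    obtain ⟨a, rfl⟩ := Submodule.Quotient.mk_surjective _ a
    exact hsmul r a)
  rw [hilbertFunction, Module.finrank, hrank, ← Module.finrank, Module.finrank_fintype_fun_eq_card]

namespace semigroupRing

theorem ext_coeff {a b : semigroupRing k S}
    (h : ∀ i, PowerSeries.coeff i (a : PowerSeries k) = PowerSeries.coeff i (b : PowerSeries k)) :
    a = b :=
  Subtype.ext (PowerSeries.ext h)

/-- The monomial `t ^ s` in `k[[S]]`. -/
noncomputable def monomial (k : Type u) [Field k] {s : ℕ} (hs : s ∈ S) : semigroupRing k S :=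
  ⟨PowerSeries.X ^ s, fun n hn => by
    rw [PowerSeries.coeff_X_pow] at hn
    obtain rfl : n = s := by_contra fun h => hn (if_neg h)
    exact hs⟩

theorem coeff_mul_monomial {s : ℕ} (hs : s ∈ S) (a : semigroupRing k S) (n : ℕ) :
    PowerSeries.coeff n ((a * monomial k hs : semigroupRing k S) : PowerSeries k) =
      if s ≤ n then PowerSeries.coeff (n - s) (a : PowerSeries k) else 0 :=
  PowerSeries.coeff_mul_X_pow' _ _ _

theorem mem_maximalIdeal_iff {a : semigroupRing k S} :
    a ∈ maximalIdeal (semigroupRing k S) ↔ PowerSeries.coeff 0 (a : PowerSeries k) = 0 := by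
  rw [mem_maximalIdeal, mem_nonunits_iff, PowerSeries.coeff_zero_eq_constantCoeff_apply]
  constructor
  · intro h
    by_contra ha
    exact h (IsUnit.of_mul_eq_one ⟨(a : PowerSeries k)⁻¹, inv_mem_semigroupRing a.2⟩
      (Subtype.ext (PowerSeries.mul_inv_cancel _ ha)))
  · intro h hu
    have := hu.map (PowerSeries.constantCoeff.comp (semigroupRing k S).val.toRingHom)
    exact this.ne_zero h

theorem mem_span_monomial_iff {s : ℕ} (hs : s ∈ S) {a : semigroupRing k S} :
    a ∈ Ideal.span {monomial k hs} ↔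
      ∀ n, PowerSeries.coeff n (a : PowerSeries k) ≠ 0 → ∃ t ∈ S, t + s = n := by
  rw [Ideal.mem_span_singleton']
  constructor
  · rintro ⟨b, rfl⟩ n hn
    rw [coeff_mul_monomial] at hn
    obtain ⟨hle, hb⟩ := ite_ne_right_iff.mp hn
    exact ⟨n - s, b.2 _ hb, by omega⟩
  · intro h
    refine ⟨⟨PowerSeries.mk fun n => PowerSeries.coeff (n + s) (a : PowerSeries k), ?_⟩, ?_⟩
    · intro n hn
      rw [PowerSeries.coeff_mk] at hn
      obtain ⟨t, ht, hts⟩ := h _ hn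
      rwa [← Nat.add_right_cancel hts]
    · refine ext_coeff fun n => ?_
      rw [coeff_mul_monomial]
      split_ifs with hle
      · rw [PowerSeries.coeff_mk, Nat.sub_add_cancel hle]
      · by_contra hne
        obtain ⟨t, -, ht⟩ := h n (Ne.symm hne)
        omega

theorem order_le_of_mem_maximalIdeal_pow {n : ℕ} : ∀ {a : semigroupRing k S},
    a ∈ maximalIdeal (semigroupRing k S) ^ n →
      ∀ i, PowerSeries.coeff i (a : PowerSeries k) ≠ 0 → n ≤ S.order i := by
  induction n with
  | zero => exact fun _ _ _ => Nat.zero_le _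
  | succ n ih =>
    intro a ha
    rw [pow_succ] at ha
    refine Submodule.mul_induction_on ha (fun b hb c hc i hi => ?_) (fun b c hb hc i hi => ?_)
    · change PowerSeries.coeff i ((b : PowerSeries k) * (c : PowerSeries k)) ≠ 0 at hi
      rw [PowerSeries.coeff_mul] at hi
      obtain ⟨p, hp, hne⟩ := Finset.exists_ne_zero_of_sum_ne_zero hi
      have hb' := left_ne_zero_of_mul hne
      have hc' := right_ne_zero_of_mul hne
      rw [← Finset.HasAntidiagonal.mem_antidiagonal.mp hp]
      have hp2 : p.2 ≠ 0 := fun h0 => hc' (h0 ▸ mem_maximalIdeal_iff.mp hc)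
      exact (add_le_add (ih hb _ hb') (AddSubmonoid.one_le_order (c.2 _ hc') hp2)).trans
        (AddSubmonoid.order_add_le (b.2 _ hb') (c.2 _ hc'))
    · by_cases h : PowerSeries.coeff i (b : PowerSeries k) = 0
      · refine hc i fun h' => hi ?_
        change PowerSeries.coeff i ((b : PowerSeries k) + (c : PowerSeries k)) = 0
        rw [map_add, h, h', add_zero]
      · exact hb i h

/-- A series all of whose exponents have order at least `n` lies in the `n`-th power of the maximal
ideal: it is a finite sum of products of `t ^ g`, with `g` one of the finitely many elements of
order one, and of series whose exponents have order at least `n - 1`. -/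
theorem mem_maximalIdeal_pow_of_order_le (hS : IsNumericalSemigroup S) {e : ℕ}
    (he : S.IsMultiplicity e) {n : ℕ} : ∀ {a : semigroupRing k S},
    (∀ i, PowerSeries.coeff i (a : PowerSeries k) ≠ 0 → n ≤ S.order i) →
      a ∈ maximalIdeal (semigroupRing k S) ^ n := by
  induction n with
  | zero => intro a _; rw [pow_zero, Ideal.one_eq_top]; trivial
  | succ n ih =>
    intro a ha
    have hdec : ∀ i, PowerSeries.coeff i (a : PowerSeries k) ≠ 0 →
        ∃ g ∈ S.level 1, ∃ b ∈ S, n ≤ S.order b ∧ g + b = i := fun i hi => by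
      obtain ⟨g, hg, hg1, hb⟩ := AddSubmonoid.exists_add_of_succ_le_order (a.2 i hi) (ha i hi)
      exact ⟨g, ⟨hg, hg1⟩, hb⟩
    choose! G hG b hb hbn hGb using hdec
    let F := (he.finite_level hS 1).toFinset
    have hF : ∀ {g}, g ∈ F ↔ g ∈ S.level 1 := (he.finite_level hS 1).mem_toFinset
    have hpart : ∀ g j, PowerSeries.coeff j (PowerSeries.mk fun j =>
        if G (j + g) = g then PowerSeries.coeff (j + g) (a : PowerSeries k) else 0) ≠ 0 →
        j ∈ S ∧ n ≤ S.order j := by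
      intro g j hj
      rw [PowerSeries.coeff_mk] at hj
      obtain ⟨h1, h2⟩ := ite_ne_right_iff.mp hj
      have h3 : b (j + g) = j := by have := hGb _ h2; omega
      exact ⟨h3 ▸ hb _ h2, h3 ▸ hbn _ h2⟩
    let B : ℕ → semigroupRing k S := fun g => ⟨PowerSeries.mk fun j =>
      if G (j + g) = g then PowerSeries.coeff (j + g) (a : PowerSeries k) else 0,
      fun j hj => (hpart g j hj).1⟩
    have hsum : a = ∑ g ∈ F.attach, B g * monomial k (hF.mp g.2).1 := by
      refine ext_coeff fun i => ?_
      rw [AddSubmonoidClass.coe_finsetSum, map_sum]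
      simp_rw [coeff_mul_monomial]
      have hterm : ∀ g : ℕ, (if g ≤ i then PowerSeries.coeff (i - g) (B g : PowerSeries k) else 0) =
          if g ≤ i ∧ G i = g then PowerSeries.coeff i (a : PowerSeries k) else 0 := by
        intro g
        by_cases hle : g ≤ i
        · rw [if_pos hle, PowerSeries.coeff_mk, Nat.sub_add_cancel hle]
          simp [hle]
        · rw [if_neg hle, if_neg fun h => hle h.1]
      simp_rw [hterm]
      rw [Finset.sum_attach F fun g =>
        if g ≤ i ∧ G i = g then PowerSeries.coeff i (a : PowerSeries k) else 0]
      by_cases hi : PowerSeries.coeff i (a : PowerSeries k) = 0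
      · simp [hi]
      · rw [Finset.sum_eq_single_of_mem (G i) (hF.mpr (hG i hi)) fun g _ hg => if_neg fun h =>
          hg h.2.symm, if_pos ⟨by have := hGb i hi; omega, rfl⟩]
    rw [hsum, pow_succ]
    refine Ideal.sum_mem _ fun g _ => Ideal.mul_mem_mul (ih fun j hj => (hpart g j hj).2)
      (mem_maximalIdeal_iff.mpr ?_)
    have hg := (hF.mp g.2).2
    have hg0 : (g : ℕ) ≠ 0 := fun h0 => by rw [h0, AddSubmonoid.order_zero] at hg; omega
    change PowerSeries.coeff 0 (PowerSeries.X ^ (g : ℕ) : PowerSeries k) = 0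
    rw [PowerSeries.coeff_X_pow, if_neg hg0.symm]

theorem mem_maximalIdeal_pow_iff (hS : IsNumericalSemigroup S) {e : ℕ} (he : S.IsMultiplicity e)
    {n : ℕ} {a : semigroupRing k S} : a ∈ maximalIdeal (semigroupRing k S) ^ n ↔
      ∀ i, PowerSeries.coeff i (a : PowerSeries k) ≠ 0 → n ≤ S.order i :=
  ⟨order_le_of_mem_maximalIdeal_pow, mem_maximalIdeal_pow_of_order_le hS he⟩

/-! ### The Hilbert function counts elements by order -/

/-- The coefficients of a series in the `n`-th power of the maximal ideal at the exponents of
order `n`. -/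
noncomputable def levelCoeff (k : Type u) [Field k] (S : AddSubmonoid ℕ) (n : ℕ) :
    ↥(maximalIdeal (semigroupRing k S) ^ n) →+ (S.level n → k) where
  toFun a i := PowerSeries.coeff i (a.1 : PowerSeries k)
  map_zero' := funext fun i => map_zero (PowerSeries.coeff (R := k) i)
  map_add' _ _ := funext fun i => map_add (PowerSeries.coeff (R := k) i) _ _

theorem levelCoeff_smul {n : ℕ} (r : semigroupRing k S)
    (a : ↥(maximalIdeal (semigroupRing k S) ^ n)) :
    levelCoeff k S n (r • a) = PowerSeries.coeff 0 (r : PowerSeries k) • levelCoeff k S n a := by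
  ext ⟨i, hiS, hi⟩
  change PowerSeries.coeff i ((r : PowerSeries k) * (a.1 : PowerSeries k)) =
    PowerSeries.coeff 0 (r : PowerSeries k) * PowerSeries.coeff i (a.1 : PowerSeries k)
  rw [PowerSeries.coeff_mul, Finset.sum_eq_single_of_mem (0, i) (by simp)]
  rintro p hp hne
  by_contra h0
  have hr := left_ne_zero_of_mul h0
  have ha := right_ne_zero_of_mul h0
  have hsum := Finset.HasAntidiagonal.mem_antidiagonal.mp hp
  have hp1 : p.1 ≠ 0 := fun h => hne (Prod.ext h (by dsimp only; omega))
  have h1 := AddSubmonoid.one_le_order (r.2 _ hr) hp1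
  have h2 := order_le_of_mem_maximalIdeal_pow a.2 _ ha
  have h3 := AddSubmonoid.order_add_le (r.2 _ hr) (a.1.2 _ ha)
  rw [hsum] at h3
  omega

theorem levelCoeff_surjective (hS : IsNumericalSemigroup S) {e : ℕ} (he : S.IsMultiplicity e)
    (n : ℕ) : Function.Surjective (levelCoeff k S n) := by
  classical
  intro c
  have hc : ∀ i, PowerSeries.coeff i (PowerSeries.mk fun i =>
      if h : i ∈ S.level n then c ⟨i, h⟩ else 0) ≠ 0 → i ∈ S.level n := by
    intro i hi
    by_contra h
    rw [PowerSeries.coeff_mk, dif_neg h] at hi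
    exact hi rfl
  refine ⟨⟨⟨_, fun i hi => (hc i hi).1⟩, (mem_maximalIdeal_pow_iff hS he).mpr
    fun i hi => (hc i hi).2.ge⟩, funext fun i => ?_⟩
  change PowerSeries.coeff (i : ℕ) (PowerSeries.mk fun i =>
    if h : i ∈ S.level n then c ⟨i, h⟩ else 0) = c i
  rw [PowerSeries.coeff_mk, dif_pos i.2]

theorem levelCoeff_eq_zero_iff (hS : IsNumericalSemigroup S) {e : ℕ} (he : S.IsMultiplicity e)
    {n : ℕ} (a : ↥(maximalIdeal (semigroupRing k S) ^ n)) :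
    levelCoeff k S n a = 0 ↔
      (a : semigroupRing k S) ∈ maximalIdeal (semigroupRing k S) ^ (n + 1) := by
  rw [mem_maximalIdeal_pow_iff hS he]
  constructor
  · intro h i hi
    have h1 := order_le_of_mem_maximalIdeal_pow a.2 i hi
    refine lt_of_le_of_ne h1 fun h2 => hi ?_
    exact congrFun h ⟨i, a.1.2 i hi, h2.symm⟩
  · intro h
    ext ⟨i, hiS, hi⟩
    by_contra hne
    have := h i hne
    omega

theorem hilbertFunction_eq (hS : IsNumericalSemigroup S) {e : ℕ} (he : S.IsMultiplicity e)
    (n : ℕ) : hilbertFunction (semigroupRing k S) n = (S.level n).ncard := by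
  have : Fintype (S.level n) := (he.finite_level hS n).fintype
  rw [Set.ncard_eq_toFinset_card', Set.toFinset_card]
  refine hilbertFunction_eq_card
    (π := PowerSeries.constantCoeff.comp (semigroupRing k S).val.toRingHom) (fun c => ?_)
    (fun r => ?_) (levelCoeff_surjective hS he n) (fun r a => ?_) (levelCoeff_eq_zero_iff hS he)
  · refine ⟨algebraMap k _ c, ?_⟩
    change PowerSeries.constantCoeff (algebraMap k (PowerSeries k) c) = c
    rw [PowerSeries.algebraMap_apply, Algebra.algebraMap_self, RingHom.id_apply,
      PowerSeries.constantCoeff_C]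
  · rw [mem_maximalIdeal_iff, PowerSeries.coeff_zero_eq_constantCoeff_apply]
    rfl
  · rw [levelCoeff_smul, PowerSeries.coeff_zero_eq_constantCoeff_apply]
    rfl

/-! ### Gorenstein semigroup rings have symmetric semigroups -/

theorem isFiniteLength_quotient_span_monomial {e : ℕ} (he : S.IsMultiplicity e) :
    IsFiniteLength (semigroupRing k S) (semigroupRing k S ⧸ Ideal.span {monomial k he.mem}) := by
  let I : Ideal (semigroupRing k S) := Ideal.span {monomial k he.mem}
  let φ : semigroupRing k S →ₗ[k] (S.apery e → k) :=
    { toFun := fun a i => PowerSeries.coeff i (a : PowerSeries k)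
      map_add' := fun _ _ => funext fun i => map_add (PowerSeries.coeff (R := k) i) _ _
      map_smul' := fun c _ => funext fun i => map_smul (PowerSeries.coeff (R := k) i) c _ }
  have hker : LinearMap.ker φ = I.restrictScalars k := by
    ext a
    rw [LinearMap.mem_ker, Submodule.restrictScalars_mem, mem_span_monomial_iff]
    constructor
    · intro h n hn
      by_contra! hne
      exact hn (congrFun h ⟨n, a.2 n hn, hne⟩)
    · intro h
      ext ⟨n, hn⟩
      by_contra hne
      obtain ⟨t, ht, hte⟩ := h n hne
      exact hn.2 t ht hte
  have : Finite (S.apery e) := he.finite_apery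
  have hfin : Module.Finite k (semigroupRing k S ⧸ I) := by
    have : Module.Finite k (semigroupRing k S ⧸ I.restrictScalars k) :=
      Module.Finite.of_injective ((I.restrictScalars k).liftQ φ hker.ge)
        (LinearMap.ker_eq_bot.mp (Submodule.ker_liftQ_eq_bot _ _ _ hker.le))
    exact Module.Finite.equiv (Submodule.Quotient.restrictScalarsEquiv k I)
  exact isFiniteLength_iff_isNoetherian_isArtinian.mpr
    ⟨isNoetherian_of_tower k inferInstance, isArtinian_of_tower k inferInstance⟩

/-- If `k[[S]]` has finite injective dimension, the Apéry set has only one element that is maximal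
for the order in which `a ≤ b` means `b - a ∈ S`: such elements give socle elements of
`k[[S]] / (t ^ e)`. -/
theorem eq_of_maximal_of_hasInjectiveDimensionLE {e : ℕ} (he : S.IsMultiplicity e) {n : ℕ}
    (hn : CategoryTheory.HasInjectiveDimensionLE
      (ModuleCat.of (semigroupRing k S) (semigroupRing k S)) n) {a b : ℕ}
    (ha : a ∈ S.apery e) (ha' : ∀ s ∈ S, s ≠ 0 → a + s ∉ S.apery e)
    (hb : b ∈ S.apery e) (hb' : ∀ s ∈ S, s ≠ 0 → b + s ∉ S.apery e) : a = b := by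
  have hsocle : ∀ c (hc : c ∈ S.apery e), (∀ s ∈ S, s ≠ 0 → c + s ∉ S.apery e) →
      ∀ r ∈ maximalIdeal (semigroupRing k S),
        r * monomial k hc.1 ∈ Ideal.span {monomial k he.mem} := by
    intro c hc hc' r hr
    rw [mem_span_monomial_iff]
    intro m hm
    rw [coeff_mul_monomial] at hm
    obtain ⟨hle, hm⟩ := ite_ne_right_iff.mp hm
    have hne : m - c ≠ 0 := fun h0 => hm (h0 ▸ mem_maximalIdeal_iff.mp hr)
    have hnot := hc' _ (r.2 _ hm) hne
    by_contra! h
    refine hnot ⟨S.add_mem hc.1 (r.2 _ hm), fun t ht hte => h t ht (by omega)⟩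
  have hnz : monomial k he.mem ∈ nonZeroDivisors (semigroupRing k S) := by
    refine mem_nonZeroDivisors_of_ne_zero fun h => ?_
    exact pow_ne_zero e PowerSeries.X_ne_zero (congrArg Subtype.val h)
  have hmem : monomial k he.mem ∈ maximalIdeal (semigroupRing k S) := by
    rw [mem_maximalIdeal_iff]
    change PowerSeries.coeff 0 (PowerSeries.X ^ e : PowerSeries k) = 0
    rw [PowerSeries.coeff_X_pow, if_neg he.ne_zero.symm]
  have hnot : monomial k ha.1 ∉ Ideal.span {monomial k he.mem} := by
    rw [mem_span_monomial_iff]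
    intro h
    obtain ⟨t, ht, hte⟩ := h a (by
      change PowerSeries.coeff a (PowerSeries.X ^ a : PowerSeries k) ≠ 0
      rw [PowerSeries.coeff_X_pow_self]
      exact one_ne_zero)
    exact ha.2 t ht hte
  obtain ⟨c, hc⟩ := exists_mul_sub_mem_of_socle hnz hmem (isFiniteLength_quotient_span_monomial he)
    (hsocle a ha ha') hnot (hsocle b hb hb') hn
  -- the exponent `b` does not occur in `c t ^ a - t ^ b`
  have h0 : PowerSeries.coeff b ((c * monomial k ha.1 : semigroupRing k S) : PowerSeries k) = 1 := by
    by_contra hne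
    obtain ⟨t, ht, hte⟩ := (mem_span_monomial_iff he.mem).mp hc b (by
      change PowerSeries.coeff b (((c * monomial k ha.1 : semigroupRing k S) : PowerSeries k) -
        PowerSeries.X ^ b) ≠ 0
      rwa [map_sub, PowerSeries.coeff_X_pow_self, sub_ne_zero])
    exact hb.2 t ht hte
  rw [coeff_mul_monomial] at h0
  have hne : (if a ≤ b then PowerSeries.coeff (b - a) (c : PowerSeries k) else 0) ≠ 0 := by
    rw [h0]; exact one_ne_zero
  obtain ⟨hle, hcoeff⟩ := ite_ne_right_iff.mp hne
  by_contra hab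
  exact ha' (b - a) (c.2 _ hcoeff) (by omega) (by rwa [Nat.add_sub_cancel' hle])

/-- If `k[[S]]` has finite injective dimension, then `S` is symmetric: the Apéry set has an element
`W` such that `W - w ∈ S` for all its elements `w`. -/
theorem exists_apery_duality {e : ℕ} (he : S.IsMultiplicity e) {n : ℕ}
    (hn : CategoryTheory.HasInjectiveDimensionLE
      (ModuleCat.of (semigroupRing k S) (semigroupRing k S)) n) :
    ∃ W ∈ S.apery e, ∀ w ∈ S.apery e, ∃ w' ∈ S, w + w' = W := by
  have hmax : ∀ w ∈ S.apery e, ∃ m ∈ S.apery e, (∃ w' ∈ S, w + w' = m) ∧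
      ∀ s ∈ S, s ≠ 0 → m + s ∉ S.apery e := by
    intro w hw
    obtain ⟨m, ⟨hm, w', hw', rfl⟩, hmax⟩ := Set.exists_max_image
      {m ∈ S.apery e | ∃ w' ∈ S, w + w' = m} id (he.finite_apery.subset (Set.sep_subset _ _))
      ⟨w, hw, 0, S.zero_mem, rfl⟩
    refine ⟨_, hm, ⟨w', hw', rfl⟩, fun s hs h0 h => ?_⟩
    have := hmax _ ⟨h, w' + s, S.add_mem hw' hs, by omega⟩
    simp only [id] at this
    omega
  obtain ⟨W, hW, -, hW'⟩ := hmax 0 he.zero_mem_apery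
  refine ⟨W, hW, fun w hw => ?_⟩
  obtain ⟨m, hm, hwm, hm'⟩ := hmax w hw
  rwa [eq_of_maximal_of_hasInjectiveDimensionLE he hn hW hW' hm hm']

end semigroupRing

end SemigroupRing

/-! ### Monotonicity of the Hilbert function -/

theorem AddSubmonoid.isMultiplicity_semigroupMultiplicity {S : AddSubmonoid ℕ}
    (hS : IsNumericalSemigroup S) : S.IsMultiplicity (semigroupMultiplicity S) := by
  have hne : {s : ℕ | s ∈ S ∧ s ≠ 0}.Nonempty := by
    obtain ⟨c, hc⟩ := hS.bddAbove
    refine ⟨c + 1, by_contra fun h => ?_, by omega⟩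
    have := hc (show c + 1 ∈ (S : Set ℕ)ᶜ from h)
    omega
  have hmem := Nat.sInf_mem hne
  exact ⟨hmem.1, hmem.2, fun s hs h0 => Nat.sInf_le ⟨hs, h0⟩⟩

theorem corollary4 (k : Type u) [Field k] (S : AddSubmonoid ℕ) (hS : IsNumericalSemigroup S)
    (hGor : IsGorensteinLocalRing (semigroupRing k S))
    (hv : semigroupMultiplicity S ≤ semigroupEmbeddingDimension S + 4) :
    Monotone (hilbertFunction (semigroupRing k S)) := by
  have he := AddSubmonoid.isMultiplicity_semigroupMultiplicity hS
  obtain ⟨n, hn⟩ := hGor.exists_hasInjectiveDimensionLE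
  obtain ⟨W, hW, hsym⟩ := semigroupRing.exists_apery_duality he hn
  refine monotone_nat_of_le_succ fun n => ?_
  rw [semigroupRing.hilbertFunction_eq hS he, semigroupRing.hilbertFunction_eq hS he]
  exact he.ncard_level_le_ncard_level_succ hS (he.ncard_jumps_le_of_symmetric hS hv hW hsym n)
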